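/- Let $n\ge 2$, let $U\subset\mathbb{R}^n$ be open, let $f,g_1,g_2:U\to\mathbb{R}^n$ be $C^\infty$, and consider the control system $$\dot x=f(x)+g_1(x)u_1+g_2(x)u_2,\qquad x\in U,\ u=(u_1,u_2)\in\mathbb{R}^2 .$$ Let $G_0=\mathrm{span}_{C^\infty(U)}\{g_1,g_2\}$ and $G_{k+1}=G_k+[G_k,G_k]$ be the derived flag, where $[G_k,G_k]$ is the $C^\infty(U)$-span of all Lie brackets of vector fields in $G_k$. Let $G_k(q)=\{X_q : X\in G_k\}\subset\mathbb{R}^n$. Let $\Lambda^k=(G_k)^\perp\subset\Omega^1(U)$ be the module of smooth one-forms on $U$ that annihilate $G_k$, let $\Lambda^k_q=\{\omega_q : \omega\in\Lambda^k\}$, and let $C^k_q$ be the retracting space of $\Lambda^k$ at $q\in U$, that is, the annihilator in $(\mathbb{R}^n)^*$ of $$A^k_q=\{X\in\mathbb{R}^n : \langle\lambda_q,X\rangle=0 \text{ and } X\lrcorner\, d\lambda_q\in\Lambda^k_q \text{ for all } \lambda\in\Lambda^k\}.$$ Suppose that there is an open dense subset $D$ of $U$ such that 1) $\dim G_k(q)=2+k$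 for all $0\le k\le n-2$ and $q\in D$; 2) $(L_f\omega)_q\in C^k_q$ for all $1\le k\le n-3$, $q\in D$ and $\omega\in\Lambda^k$. Then there is an open dense subset $V$ of $U$ such that, for every $p\in V$, there are a $C^\infty$ change of coordinates $z=\varphi(x)$ and a regular static state feedback $u=\alpha(x)+\beta(x)v$ (with $\alpha$, $\beta$ of class $C^\infty$ and $\beta(x)\in\mathbb{R}^{2\times 2}$ invertible at every point), both defined on an open neighborhood $W\subset U$ of $p$, in which the closed-loop system is given on $\varphi(W)$ by the triangular form $$\begin{aligned}\dot z_i&=\phi_i(z_1,\dots,z_{i+1},z_n)+z_{i+1}v_1\quad(1\le i\le n-3),\\ \dot z_{n-2}&=\phi_{n-2}(z_1,\dots,z_n)+z_{n-1}v_1,\\ \dot z_{n-1}&=v_2,\qquad \dot z_n=v_1,\end{aligned}$$ with $C^\infty$ functions $\phi_1,\dots,\phi_{n-2}$ (the first two lines are void where their index ranges are empty). -/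

import Mathlib

open scoped ContDiff

noncomputable section

/-- The state space `ℝⁿ`. -/
abbrev State (n : ℕ) : Type := Fin n → ℝ

/-- Vector fields on (subsets of) `ℝⁿ`. Only the values on the open set under consideration matter. -/
abbrev VecField (n : ℕ) : Type := State n → State n

/-- Differential one-forms on (subsets of) `ℝⁿ`. -/
abbrev OneForm (n : ℕ) : Type := State n → (State n →L[ℝ] ℝ)

/-- The ring `C^∞(U)`. -/
def smoothFun {n : ℕ} (U : Set (State n)) : Subalgebra ℝ (State n → ℝ) where
  carrier := {a | ContDiffOn ℝ ∞ a U}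
  mul_mem' ha hb := ContDiffOn.mul ha hb
  add_mem' ha hb := ContDiffOn.add ha hb
  algebraMap_mem' _ := contDiffOn_const

/-- `C^∞(U)` acts on vector fields pointwise. -/
theorem smoothFun_smul_vecField {n : ℕ} {U : Set (State n)} (a : smoothFun U) (X : VecField n)
    (x : State n) : (a • X) x = (a : State n → ℝ) x • X x := rfl

/-- `C^∞(U)` acts on one-forms pointwise. -/
theorem smoothFun_smul_oneForm {n : ℕ} {U : Set (State n)} (a : smoothFun U) (θ : OneForm n)
    (x : State n) : (a • θ) x = (a : State n → ℝ) x • θ x := rfl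

/-- A distribution on `U`: a `C^∞(U)`-submodule of vector fields. -/
abbrev VecDistribution {n : ℕ} (U : Set (State n)) : Type := Submodule (smoothFun U) (VecField n)

/-- A codistribution on `U`: a `C^∞(U)`-submodule of one-forms. -/
abbrev Codistribution {n : ℕ} (U : Set (State n)) : Type := Submodule (smoothFun U) (OneForm n)

/-- The subspace `Δ_q = {X_q | X ∈ Δ}` of the tangent space at `q`. -/
def VecDistribution.atPoint {n : ℕ} {U : Set (State n)} (Δ : VecDistribution U) (q : State n) :
    Submodule ℝ (State n) where
  carrier := {w | ∃ X ∈ Δ, X q = w}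
  add_mem' := by
    rintro _ _ ⟨X, hX, rfl⟩ ⟨Y, hY, rfl⟩
    exact ⟨X + Y, Δ.add_mem hX hY, rfl⟩
  zero_mem' := ⟨0, Δ.zero_mem, rfl⟩
  smul_mem' := by
    rintro c _ ⟨X, hX, rfl⟩
    exact ⟨algebraMap ℝ (smoothFun U) c • X, Δ.smul_mem _ hX, rfl⟩

/-- The subspace `Λ_q = {θ_q | θ ∈ Λ}` of the cotangent space at `q`. -/
def Codistribution.atPoint {n : ℕ} {U : Set (State n)} (Λ : Codistribution U) (q : State n) :
    Submodule ℝ (State n →L[ℝ] ℝ) where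
  carrier := {η | ∃ θ ∈ Λ, θ q = η}
  add_mem' := by
    rintro _ _ ⟨X, hX, rfl⟩ ⟨Y, hY, rfl⟩
    exact ⟨X + Y, Λ.add_mem hX hY, rfl⟩
  zero_mem' := ⟨0, Λ.zero_mem, rfl⟩
  smul_mem' := by
    rintro c _ ⟨X, hX, rfl⟩
    exact ⟨algebraMap ℝ (smoothFun U) c • X, Λ.smul_mem _ hX, rfl⟩

/-- `[Δ₁, Δ₂]`: the `C^∞(U)`-span of the Lie brackets `[X, Y]` with `X ∈ Δ₁`, `Y ∈ Δ₂`. -/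
def VecDistribution.bracket {n : ℕ} {U : Set (State n)} (Δ₁ Δ₂ : VecDistribution U) : VecDistribution U :=
  Submodule.span (smoothFun U)
    {Z | ∃ X ∈ Δ₁, ∃ Y ∈ Δ₂, Z = VectorField.lieBracket ℝ X Y}

/-- The derived flag of `Δ`: `G₀ = Δ`, `G_{k+1} = G_k + [G_k, G_k]`. -/
def derivedFlag {n : ℕ} {U : Set (State n)} (Δ : VecDistribution U) : ℕ → VecDistribution U
  | 0 => Δ
  | k + 1 => derivedFlag Δ k ⊔ (derivedFlag Δ k).bracket (derivedFlag Δ k)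

/-- The derived flag `(G_k)` of the distribution `span {g₁, g₂}` over `C^∞(U)`. -/
def controlFlag {n : ℕ} (U : Set (State n)) (g₁ g₂ : VecField n) : ℕ → VecDistribution U :=
  derivedFlag (Submodule.span (smoothFun U) {g₁, g₂})

/-- The annihilator `Δ^⊥ ⊆ Ω¹(U)`: the smooth one-forms on `U` that vanish on `Δ`. -/
def VecDistribution.annihilator {n : ℕ} {U : Set (State n)} (Δ : VecDistribution U) : Codistribution U where
  carrier := {θ | ContDiffOn ℝ ∞ θ U ∧ ∀ X ∈ Δ, ∀ x ∈ U, θ x (X x) = 0}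
  add_mem' := by
    rintro θ η ⟨h1, h2⟩ ⟨h3, h4⟩
    exact ⟨h1.add h3, fun X hX x hx => by simp [h2 X hX x hx, h4 X hX x hx]⟩
  zero_mem' := ⟨contDiffOn_const, fun _ _ _ _ => rfl⟩
  smul_mem' := by
    rintro a θ ⟨h1, h2⟩
    refine ⟨ContDiffOn.smul a.2 h1, fun X hX x hx => ?_⟩
    rw [smoothFun_smul_oneForm]
    simp [h2 X hX x hx]

/-- The contraction `X ↦ X ⌟ dθ_q` of the exterior derivative of the one-form `θ` at `q`
(one-forms are identified with alternating forms in one variable). -/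
def contractExtDeriv {n : ℕ} (θ : OneForm n) (q : State n) :
    State n →ₗ[ℝ] (State n →L[ℝ] ℝ) :=
  (ContinuousAlternatingMap.ofSubsingletonLIE (𝕜 := ℝ) (E := State n) (F := ℝ)
      (0 : Fin 1)).symm.toLinearEquiv.toLinearMap ∘ₗ
    (ContinuousAlternatingMap.curryLeft
      (extDeriv (fun x => ContinuousAlternatingMap.ofSubsingletonLIE (𝕜 := ℝ) (E := State n) (F := ℝ)
        (0 : Fin 1) (θ x)) q)).toLinearMap

/-- `(X ⌟ dθ_q)(Y) = dθ_q(X, Y) = (D_X θ)_q(Y) - (D_Y θ)_q(X)`. -/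
theorem contractExtDeriv_apply {n : ℕ} (θ : OneForm n) (q X Y : State n) :
    contractExtDeriv θ q X Y = fderiv ℝ θ q X Y - fderiv ℝ θ q Y X := by
  have h := (ContinuousAlternatingMap.ofSubsingletonLIE (𝕜 := ℝ) (E := State n) (F := ℝ)
      (0 : Fin 1)).toContinuousLinearEquiv.comp_fderiv (f := θ) (x := q)
  change extDeriv (fun x => ContinuousAlternatingMap.ofSubsingletonLIE (𝕜 := ℝ) (E := State n)
    (F := ℝ) (0 : Fin 1) (θ x)) q (Matrix.vecCons X (fun _ => Y)) = _
  rw [extDeriv, ContinuousAlternatingMap.alternatizeUncurryFin_apply, Fin.sum_univ_two]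
  change fderiv ℝ (_ ∘ θ) q = _ at h
  simp only [Function.comp_def] at h
  erw [h]
  simp [Fin.removeNth, sub_eq_add_neg]

/-- The associated (Cauchy characteristic) space `A(Λ)_q`: all `X` with `⟨λ_q, X⟩ = 0` and
`X ⌟ dλ_q ∈ Λ_q` for every `λ ∈ Λ`. -/
def Codistribution.associated {n : ℕ} {U : Set (State n)} (Λ : Codistribution U) (q : State n) :
    Submodule ℝ (State n) where
  carrier := {X | ∀ θ ∈ Λ, θ q X = 0 ∧ contractExtDeriv θ q X ∈ Λ.atPoint q}
  add_mem' := by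
    intro X Y hX hY θ hθ
    obtain ⟨h1, h2⟩ := hX θ hθ
    obtain ⟨h3, h4⟩ := hY θ hθ
    refine ⟨by simp [h1, h3], ?_⟩
    rw [map_add]
    exact Submodule.add_mem _ h2 h4
  zero_mem' := fun θ _ => ⟨map_zero _, by rw [map_zero]; exact Submodule.zero_mem _⟩
  smul_mem' := by
    intro c X hX θ hθ
    obtain ⟨h1, h2⟩ := hX θ hθ
    refine ⟨by simp [h1], ?_⟩
    rw [map_smul]
    exact Submodule.smul_mem _ c h2

/-- The retracting space `C(Λ)_q = (A(Λ)_q)^⊥`. -/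
def Codistribution.retracting {n : ℕ} {U : Set (State n)} (Λ : Codistribution U) (q : State n) :
    Submodule ℝ (State n →L[ℝ] ℝ) where
  carrier := {η | ∀ X ∈ Λ.associated q, η X = 0}
  add_mem' := fun h1 h2 X hX => by simp [h1 X hX, h2 X hX]
  zero_mem' := fun _ _ => rfl
  smul_mem' := fun c _ h X hX => by simp [h X hX]

/-- The Lie derivative `(L_f θ)_q` of a one-form:
`(L_f θ)_q(Y) = (D_f θ)_q(Y) + θ_q(Df_q(Y))`. -/
def lieDerivOneForm {n : ℕ} (f : VecField n) (θ : OneForm n) (q : State n) :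
    State n →L[ℝ] ℝ :=
  fderiv ℝ θ q (f q) + (θ q).comp (fderiv ℝ f q)

/-- `D` is an open dense subset of `U`. -/
def IsOpenDenseIn {n : ℕ} (D U : Set (State n)) : Prop :=
  IsOpen D ∧ D ⊆ U ∧ U ⊆ closure D

/-- Right-hand side of the triangular form in dimension `n` with control value `v = (v₁, v₂)`.
With 0-based indices the components are
`ϕ_i(z) + z_{i+1} v₁` for `i < n - 2`, then `v₂` for `i = n - 2` and `v₁` for `i = n - 1`. -/
def triangularRHS {n : ℕ} (ϕ : Fin n → State n → ℝ) (z : State n) (v : Fin 2 → ℝ) : State n :=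
  fun i =>
    if h : (i : ℕ) + 2 < n then ϕ i z + z ⟨(i : ℕ) + 1, by omega⟩ * v 0
    else if (i : ℕ) + 2 = n then v 1
    else v 0

/-- The variables on which the drift component with 0-based index `i < n - 2` may depend:
the coordinates with (0-based) indices `0, …, i + 1` and the last coordinate. -/
def allowedVars {n : ℕ} (i : Fin n) : Set (Fin n) :=
  {j | (j : ℕ) ≤ (i : ℕ) + 1 ∨ (j : ℕ) + 1 = n}

/-- Around `p`, the system `ẋ = f(x) + g₁(x) u₁ + g₂(x) u₂` on `U` takes the triangular form:
there are a smooth change of coordinates `z = φ(x)` and a regular static state feedback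
`u = α(x) + β(x) v`, both defined on an open neighbourhood `W ⊆ U` of `p` (the source of `φ`),
such that the closed-loop system in the coordinates `z` is in triangular form on `φ(W)`. -/
def TriangularAround {n : ℕ} (U : Set (State n)) (f g₁ g₂ : VecField n) (p : State n) : Prop :=
  ∃ (φ : OpenPartialHomeomorph (State n) (State n))
    (α : State n → Fin 2 → ℝ) (β : State n → Matrix (Fin 2) (Fin 2) ℝ)
    (ϕ : Fin n → State n → ℝ),
    p ∈ φ.source ∧ φ.source ⊆ U ∧
    ContDiffOn ℝ ∞ φ φ.source ∧ ContDiffOn ℝ ∞ φ.symm φ.target ∧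
    ContDiffOn ℝ ∞ α φ.source ∧
    (∀ i j, ContDiffOn ℝ ∞ (fun x => β x i j) φ.source) ∧
    (∀ x ∈ φ.source, IsUnit (β x)) ∧
    (∀ i : Fin n, (i : ℕ) + 2 < n →
      ContDiffOn ℝ ∞ (ϕ i) φ.target ∧ DependsOn (ϕ i) (allowedVars i)) ∧
    ∀ x ∈ φ.source, ∀ v u : Fin 2 → ℝ, u = α x + (β x).mulVec v →
      fderiv ℝ φ x (f x + u 0 • g₁ x + u 1 • g₂ x) = triangularRHS ϕ (φ x) v

end

/-!
The derived flag of `span {g₁, g₂}` is a Goursat flag on `D`, so by the classical theorem of von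
Weber and Cartan it has chained coordinates near generic points. For `n ≥ 3` the annihilator of
`G_{n-3}` is spanned, near each point of `D`, by a single one-form `θ`. As `dθ` vanishes on
`G_{n-4}` (for `n = 3`, on lines) but not on `G_{n-3}`, it has rank exactly two on `ker θ`, and `θ`
is a combination of two differentials `da` and `ds`
(`exists_pfaff_coordinates`). From there on no integration is needed: with `w₀ = s`, `w₁ = a`, the
closedness of the previous forms forces `dw_{j+1} ∧ ds` to vanish on `G_{n-3-j}`, so the next
coordinate is the ratio `w_{j+2} = dw_{j+1} / ds` on that distribution
(`IsPartialChain.exists_succ`). The growth of the derived flag guarantees both that `ds` does not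
vanish identically there, which is the only place where the point has to be generic, and that the
differentials stay independent. In the end the forms `dw_{i+1} - w_{i+2} ds` annihilate `g₁` and
`g₂`, and a regular feedback turns `ds/dt` and `dw_{n-1}/dt` into the new controls.

The remaining drift components are `dw_{i+1}(f) - w_{i+2} ds(f)`. Vectors killed by
`ds, dw₁, …, dw_{i+2}` are Cauchy characteristics of the annihilator of `G_{n-3-i}`. The hypothesis
on `L_f` says that the derivatives of the drift components along them vanish
(`IsPartialChain.fderiv_drift_eq_zero`), so on a box these components depend on the allowed
variables only.

The two integrations in Pfaff's theorem use Frobenius' theorem (`exists_first_integrals`), which is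
proved here from the smooth dependence of flows on parameters; the latter is obtained from the
inverse function theorem in the Banach space of continuous curves. The set of points around which
the triangular form exists is open, so for the theorem it suffices to find one such point in every
nonempty open subset of `D`.
-/

noncomputable section

/-! ### Smooth dependence of flows on parameters -/

section Flow

open Set Filter Topology unitInterval

variable {T : Type*} [TopologicalSpace T]

/-- Pointwise application of a curve of operators to a curve of vectors, as a bounded bilinear map
on spaces of continuous curves. -/
def curveApply (T : Type*) [TopologicalSpace T] [CompactSpace T] (G H : Type*)
    [NormedAddCommGroup G] [NormedSpace ℝ G] [NormedAddCommGroup H] [NormedSpace ℝ H] :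
    C(T, G →L[ℝ] H) →L[ℝ] C(T, G) →L[ℝ] C(T, H) :=
  LinearMap.mkContinuous₂
    (LinearMap.mk₂ ℝ (fun (A : C(T, G →L[ℝ] H)) (γ : C(T, G)) =>
      (⟨fun s => A s (γ s), by fun_prop⟩ : C(T, H)))
      (by intros; ext; simp) (by intros; ext; simp) (by intros; ext; simp) (by intros; ext; simp))
    1 (by
      intro A γ
      rw [ContinuousMap.norm_le _ (by positivity)]
      intro s
      have h1 := A.norm_coe_le_norm s
      have h2 := γ.norm_coe_le_norm s
      calc ‖A s (γ s)‖ ≤ ‖A s‖ * ‖γ s‖ := (A s).le_opNorm _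
        _ ≤ 1 * ‖A‖ * ‖γ‖ := by rw [one_mul]; gcongr)

/-- The superposition operator `γ ↦ g ∘ γ` on continuous curves. -/
def superposition (T : Type*) [TopologicalSpace T] {G H : Type*} [TopologicalSpace G]
    [TopologicalSpace H] (g : C(G, H)) (γ : C(T, G)) : C(T, H) := g.comp γ

theorem hasFDerivAt_superposition [CompactSpace T] {G H : Type*} [NormedAddCommGroup G]
    [NormedSpace ℝ G] [NormedAddCommGroup H] [NormedSpace ℝ H] (g : C(G, H)) (g' : C(G, G →L[ℝ] H))
    (hg : ∀ x, HasFDerivAt g (g' x) x) (γ : C(T, G)) :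
    HasFDerivAt (superposition T g) (curveApply T G H (superposition T g' γ)) γ := by
  rw [hasFDerivAt_iff_isLittleO_nhds_zero, Asymptotics.isLittleO_iff]
  intro ε hε
  have hc : Continuous (superposition T g' : C(T, G) → C(T, G →L[ℝ] H)) :=
    ContinuousMap.continuous_postcomp g'
  obtain ⟨δ, hδ, hδ'⟩ : ∃ δ > 0, ∀ x, dist x γ < δ →
      dist (superposition T g' x) (superposition T g' γ) < ε :=
    Metric.continuousAt_iff.1 hc.continuousAt ε hε
  filter_upwards [Metric.ball_mem_nhds (0 : C(T, G)) hδ] with h hh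
  rw [mem_ball_zero_iff] at hh
  rw [ContinuousMap.norm_le _ (by positivity)]
  intro s
  have key := (convex_segment (γ s) (γ s + h s)).norm_image_sub_le_of_norm_hasFDerivWithin_le'
    (𝕜 := ℝ) (f := g) (f' := fun x => g' x) (φ := g' (γ s)) (C := ε)
    (fun x _ => (hg x).hasFDerivWithinAt) ?_ (left_mem_segment ℝ _ _) (right_mem_segment ℝ _ _)
  · simp only [add_sub_cancel_left] at key
    refine key.trans ?_
    gcongr
    exact h.norm_coe_le_norm s
  · intro x hx
    rw [segment_eq_image'] at hx
    obtain ⟨t, ⟨ht0, ht1⟩, rfl⟩ := hx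
    have h1 : dist (γ + t • h) γ < δ := by
      rw [dist_eq_norm, add_sub_cancel_left, norm_smul, Real.norm_of_nonneg ht0]
      nlinarith [norm_nonneg h]
    have h2 := ((ContinuousMap.dist_apply_le_dist s).trans_lt (hδ' _ h1)).le
    rw [dist_eq_norm] at h2
    simp only [add_sub_cancel_left]
    exact h2

/-- The superposition operator of a smooth map is smooth. -/
theorem contDiff_superposition [CompactSpace T] {G H : Type} [NormedAddCommGroup G]
    [NormedSpace ℝ G] [NormedAddCommGroup H] [NormedSpace ℝ H] (g : C(G, H)) (hg : ContDiff ℝ ∞ g) :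
    ContDiff ℝ ∞ (superposition T g) := by
  rw [contDiff_infty]
  intro m
  induction m generalizing H with
  | zero => exact contDiff_zero.2 (ContinuousMap.continuous_postcomp g)
  | succ m ih =>
    have hd : ContDiff ℝ ∞ (fderiv ℝ g) := hg.fderiv_right (by simp)
    let g' : C(G, G →L[ℝ] H) := ⟨fderiv ℝ g, hd.continuous⟩
    push_cast
    rw [contDiff_succ_iff_hasFDerivAt]
    have hB : ContDiff ℝ m (curveApply T G H) := by fun_prop
    exact ⟨fun γ => curveApply T G H (superposition T g' γ), hB.comp (ih g' hd),
      hasFDerivAt_superposition g g' fun x => (hg.differentiable (by simp) x).hasFDerivAt⟩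

/-- A smooth map with invertible derivative at a point restricts to a diffeomorphism between open
sets. -/
theorem exists_openPartialHomeomorph_contDiffOn {A B : Type*} [NormedAddCommGroup A]
    [NormedSpace ℝ A] [CompleteSpace A] [NormedAddCommGroup B] [NormedSpace ℝ B] {f : A → B}
    {W : Set A} (hW : IsOpen W) (hf : ContDiffOn ℝ ∞ f W) {p : A} (hp : p ∈ W) (e : A ≃L[ℝ] B)
    (he : fderiv ℝ f p = e) :
    ∃ φ : OpenPartialHomeomorph A B, ⇑φ = f ∧ p ∈ φ.source ∧ φ.source ⊆ W ∧
      ContDiffOn ℝ ∞ φ.symm φ.target := by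
  have hfp : ContDiffAt ℝ ∞ f p := hf.contDiffAt (hW.mem_nhds hp)
  have hd : HasFDerivAt f (e : A →L[ℝ] B) p :=
    he ▸ (hfp.differentiableAt (by simp)).hasFDerivAt
  have hO : IsOpen (W ∩ fderiv ℝ f ⁻¹' range ((↑) : (A ≃L[ℝ] B) → A →L[ℝ] B)) :=
    (hf.continuousOn_fderiv_of_isOpen hW (by simp)).isOpen_inter_preimage hW
      ContinuousLinearEquiv.isOpen
  refine ⟨(hfp.toOpenPartialHomeomorph f hd (by simp)).restrOpen _ hO, rfl,
    ⟨hfp.mem_toOpenPartialHomeomorph_source hd _, hp, e, he.symm⟩, fun x hx => hx.2.1, ?_⟩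
  intro y hy
  set φ := (hfp.toOpenPartialHomeomorph f hd (by simp)).restrOpen _ hO
  have hx : φ.symm y ∈ φ.source := φ.map_target hy
  obtain ⟨e', he'⟩ := hx.2.2
  have hfx : ContDiffAt ℝ ∞ f (φ.symm y) := hf.contDiffAt (hW.mem_nhds hx.2.1)
  refine (φ.contDiffAt_symm (f₀' := e') hy ?_ hfx).contDiffWithinAt
  rw [he']
  exact (hfx.differentiableAt (by simp)).hasFDerivAt

/-- The implicit function theorem for the fixed point equation `γ = c₂ z + B (N γ) (c₁ z)` with a
smooth map `N`, a bounded bilinear map `B` and bounded linear maps `c₁`, `c₂`: near a parameter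
`z₀` with `c₁ z₀ = 0` there is a smooth family of solutions. -/
theorem exists_contDiffOn_fixedPoint {Z C C' : Type*} [NormedAddCommGroup Z] [NormedSpace ℝ Z]
    [CompleteSpace Z] [NormedAddCommGroup C] [NormedSpace ℝ C] [CompleteSpace C]
    [NormedAddCommGroup C'] [NormedSpace ℝ C'] (N : C → C') (hN : ContDiff ℝ ∞ N)
    (B : C' →L[ℝ] C →L[ℝ] C) (c₁ c₂ : Z →L[ℝ] C) (z₀ : Z) (hz₀ : c₁ z₀ = 0) :
    ∃ (O : Set Z) (Γ : Z → C), IsOpen O ∧ z₀ ∈ O ∧ ContDiffOn ℝ ∞ Γ O ∧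
      Γ z₀ = c₂ z₀ ∧ ∀ z ∈ O, Γ z = c₂ z + B (N (Γ z)) (c₁ z) ∧
        ∀ v, fderiv ℝ Γ z v = c₂ v + (B (fderiv ℝ N (Γ z) (fderiv ℝ Γ z v)) (c₁ z) +
          B (N (Γ z)) (c₁ v)) := by
  let f : Z × C → Z × C := fun w => (w.1, w.2 - (c₂ w.1 + B (N w.2) (c₁ w.1)))
  have hf : ContDiff ℝ ∞ f := by fun_prop
  let γ₀ : C := c₂ z₀
  let L : Z →L[ℝ] C := c₂ + B (N γ₀) ∘L c₁
  let e : (Z × C) ≃L[ℝ] (Z × C) :=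
    ContinuousLinearEquiv.equivOfInverse
      ((ContinuousLinearMap.fst ℝ _ _).prod
        (ContinuousLinearMap.snd ℝ _ _ - L ∘L ContinuousLinearMap.fst ℝ _ _))
      ((ContinuousLinearMap.fst ℝ _ _).prod
        (ContinuousLinearMap.snd ℝ _ _ + L ∘L ContinuousLinearMap.fst ℝ _ _))
      (fun w => by simp) (fun w => by simp)
  have he : HasFDerivAt f (e : _ →L[ℝ] _) (z₀, γ₀) := by
    have h0 : HasFDerivAt (fun w : Z × C => N w.2)
        (fderiv ℝ N γ₀ ∘L ContinuousLinearMap.snd ℝ Z C) (z₀, γ₀) :=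
      HasFDerivAt.comp (f := Prod.snd) (z₀, γ₀)
        (hN.differentiable (by simp) γ₀).hasFDerivAt hasFDerivAt_snd
    have h11 : HasFDerivAt (fun w : Z × C => c₁ w.1) (c₁ ∘L ContinuousLinearMap.fst ℝ Z C)
        (z₀, γ₀) := (c₁ ∘L ContinuousLinearMap.fst ℝ Z C).hasFDerivAt
    have h12 : HasFDerivAt (fun w : Z × C => c₂ w.1) (c₂ ∘L ContinuousLinearMap.fst ℝ Z C)
        (z₀, γ₀) := (c₂ ∘L ContinuousLinearMap.fst ℝ Z C).hasFDerivAt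
    have h3 := B.hasFDerivAt_of_bilinear h0 h11
    have h4 := (hasFDerivAt_fst (𝕜 := ℝ) (p := (z₀, γ₀))).prodMk
      ((hasFDerivAt_snd (𝕜 := ℝ) (p := (z₀, γ₀))).sub (h12.add h3))
    refine h4.congr_fderiv ?_
    ext w
    all_goals simp [e, L, hz₀]
  obtain ⟨φ, hφ, hpφ, -, hsymm⟩ := exists_openPartialHomeomorph_contDiffOn isOpen_univ
    hf.contDiffOn (mem_univ (z₀, γ₀)) e he.fderiv
  -- The solution for the parameter `z` is the second component of the preimage of `(z, 0)`.
  have hj : Continuous fun z : Z => (z, (0 : C)) := by fun_prop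
  have hf0 : φ (z₀, γ₀) = (z₀, 0) := by
    rw [hφ]
    simp [f, γ₀, hz₀]
  have hO : IsOpen ((fun z : Z => (z, (0 : C))) ⁻¹' φ.target) := φ.open_target.preimage hj
  have hΓ : ContDiffOn ℝ ∞ (fun z => (φ.symm (z, 0)).2) ((fun z => (z, 0)) ⁻¹' φ.target) :=
    contDiff_snd.comp_contDiffOn
      (hsymm.comp (contDiff_id.prodMk contDiff_const).contDiffOn fun z hz => hz)
  have hfix : ∀ z ∈ (fun z : Z => (z, (0 : C))) ⁻¹' φ.target,
      (φ.symm (z, 0)).2 = c₂ z + B (N (φ.symm (z, 0)).2) (c₁ z) := by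
    intro z hz
    have h6 : f (φ.symm (z, 0)) = (z, 0) := by rw [← hφ]; exact φ.right_inv hz
    have h7 : (φ.symm (z, 0)).1 = z := congrArg Prod.fst h6
    have h8 := congrArg Prod.snd h6
    simp only [f, h7] at h8
    exact sub_eq_zero.1 h8
  refine ⟨_, fun z => (φ.symm (z, 0)).2, hO, ?_, hΓ, ?_, fun z hz => ⟨hfix z hz, fun v => ?_⟩⟩
  · change (z₀, (0 : C)) ∈ φ.target
    rw [← hf0]
    exact φ.map_source hpφ
  · change (φ.symm (z₀, 0)).2 = _
    rw [← hf0, φ.left_inv hpφ]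
  · set Γ : Z → C := fun z => (φ.symm (z, 0)).2
    have hd : HasFDerivAt Γ (fderiv ℝ Γ z) z :=
      ((hΓ.contDiffAt (hO.mem_nhds hz)).differentiableAt (by simp)).hasFDerivAt
    have h0 : HasFDerivAt (fun z => N (Γ z)) (fderiv ℝ N (Γ z) ∘L fderiv ℝ Γ z) z :=
      (hN.differentiable (by simp) (Γ z)).hasFDerivAt.comp z hd
    have h3 := c₂.hasFDerivAt.add (B.hasFDerivAt_of_bilinear h0 c₁.hasFDerivAt)
    have h4 := hd.unique (h3.congr_of_eventuallyEq
      (Filter.eventually_of_mem (hO.mem_nhds hz) fun y hy => hfix y hy))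
    conv_lhs => rw [h4]
    simp [add_comm]

/-- Integration from `0`, as an operator on curves over the unit interval. -/
def integrateCurve (E : Type*) [NormedAddCommGroup E] [NormedSpace ℝ E] :
    C(I, E) →L[ℝ] C(I, E) :=
  LinearMap.mkContinuous
    { toFun := fun γ => ⟨fun t => ∫ s in (0 : ℝ)..t, IccExtend zero_le_one γ s,
        (intervalIntegral.continuous_primitive
          (fun a b => (γ.continuous.Icc_extend').intervalIntegrable a b) 0).comp
            continuous_subtype_val⟩
      map_add' := fun γ η => by
        ext t
        change ∫ s in (0 : ℝ)..t, (IccExtend zero_le_one γ s + IccExtend zero_le_one η s) = _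
        exact intervalIntegral.integral_add (γ.continuous.Icc_extend'.intervalIntegrable _ _)
          (η.continuous.Icc_extend'.intervalIntegrable _ _)
      map_smul' := fun c γ => by
        ext t
        exact intervalIntegral.integral_smul c (IccExtend zero_le_one γ) }
    1 (by
      intro γ
      rw [ContinuousMap.norm_le _ (by positivity)]
      intro t
      refine (intervalIntegral.norm_integral_le_of_norm_le_const (C := ‖γ‖)
        fun s _ => γ.norm_coe_le_norm _).trans ?_
      rw [sub_zero, abs_of_nonneg t.2.1]
      nlinarith [t.2.2, norm_nonneg γ])

theorem hasDerivAt_integrateCurve {E : Type*} [NormedAddCommGroup E] [NormedSpace ℝ E]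
    [CompleteSpace E] (γ : C(I, E)) (t : ℝ) :
    HasDerivAt (fun t => ∫ s in (0 : ℝ)..t, IccExtend zero_le_one γ s)
      (IccExtend zero_le_one γ t) t :=
  (γ.continuous.Icc_extend').integral_hasStrictDerivAt 0 t |>.hasDerivAt

variable {E : Type} [NormedAddCommGroup E] [NormedSpace ℝ E] [CompleteSpace E]

/-- Constant curves, as a bounded linear map. -/
def constCurve (E : Type*) [NormedAddCommGroup E] [NormedSpace ℝ E] : E →L[ℝ] C(I, E) :=
  LinearMap.mkContinuous
    { toFun := ContinuousMap.const I, map_add' := fun _ _ => rfl, map_smul' := fun _ _ => rfl } 1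
    fun x => by
      rw [one_mul]
      exact (ContinuousMap.norm_le _ (norm_nonneg _)).2 fun _ => le_rfl

/-- The initial value problem `γ' = A(γ) k`, `γ(0) = y`, written as an integral equation, has
solutions over the unit interval that depend smoothly on `(k, y)`, for `(k, y)` near `(0, p)`. Their
derivatives in direction `(l, w)` solve the linearized integral equation. -/
theorem exists_contDiffOn_flow (A : C(E, E →L[ℝ] E)) (hA : ContDiff ℝ ∞ A)
    (A' : C(E, E →L[ℝ] E →L[ℝ] E)) (hA' : ∀ x, HasFDerivAt A (A' x) x) (p : E) :
    ∃ (O : Set (E × E)) (Γ : E × E → C(I, E)), IsOpen O ∧ (0, p) ∈ O ∧ ContDiffOn ℝ ∞ Γ O ∧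
      Γ (0, p) = constCurve E p ∧ ∀ z ∈ O, Γ z = constCurve E z.2 +
        integrateCurve E (curveApply I E E (superposition I A (Γ z)) (constCurve E z.1)) ∧
      ∀ v, fderiv ℝ Γ z v = constCurve E v.2 + (integrateCurve E (curveApply I E E
        (curveApply I _ _ (superposition I A' (Γ z)) (fderiv ℝ Γ z v)) (constCurve E z.1)) +
        integrateCurve E (curveApply I E E (superposition I A (Γ z)) (constCurve E v.1))) := by
  obtain ⟨O, Γ, hO, hp, hΓ, h0, h⟩ := exists_contDiffOn_fixedPoint (superposition I A)
    (contDiff_superposition A hA)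
    (ContinuousLinearMap.compL ℝ C(I, E) C(I, E) C(I, E) (integrateCurve E) ∘L curveApply I E E)
    (constCurve E ∘L ContinuousLinearMap.fst ℝ E E) (constCurve E ∘L ContinuousLinearMap.snd ℝ E E)
    (0, p) (by simp)
  refine ⟨O, Γ, hO, hp, hΓ, h0, fun z hz => ⟨(h z hz).1, fun v => ?_⟩⟩
  have h1 := (h z hz).2 v
  rw [(hasFDerivAt_superposition A A' hA' (Γ z)).fderiv] at h1
  exact h1

/-- If the vector fields `x ↦ A(x) k` commute pairwise on an open set `W`, their flows combine to a
smooth map `Y` with `∂Y/∂k = A(Y)`. -/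
theorem exists_commuting_flow (A : E → E →L[ℝ] E) (hA : ContDiff ℝ ∞ A) {W : Set E}
    (hW : IsOpen W) {p : E} (hp : p ∈ W)
    (hcomm : ∀ x ∈ W, ∀ k l, fderiv ℝ A x (A x k) l = fderiv ℝ A x (A x l) k) :
    ∃ (O : Set (E × E)) (Y : E × E → E), IsOpen O ∧ (0, p) ∈ O ∧ ContDiffOn ℝ ∞ Y O ∧
      Y (0, p) = p ∧ (∀ v, fderiv ℝ Y (0, p) (0, v) = v) ∧
      ∀ z ∈ O, Y z ∈ W ∧ ∀ l, fderiv ℝ Y z (l, 0) = A (Y z) l := by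
  have hdA : ∀ x, HasFDerivAt A (fderiv ℝ A x) x :=
    fun x => (hA.differentiable (by simp) x).hasFDerivAt
  have hA'c : Continuous (fderiv ℝ A) := hA.continuous_fderiv (by simp)
  obtain ⟨O, Γ, hO, hpO, hΓ, hΓ0, h⟩ := exists_contDiffOn_flow ⟨A, hA.continuous⟩ hA
    ⟨fderiv ℝ A, hA'c⟩ hdA p
  let ev : C(I, E) →L[ℝ] E := ContinuousMap.evalCLM ℝ 1
  have hO' : IsOpen (O ∩ Γ ⁻¹' {γ | MapsTo γ univ W}) :=
    hΓ.continuousOn.isOpen_inter_preimage hO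
      (ContinuousMap.isOpen_setOfPred_mapsTo isCompact_univ hW)
  have hdΓ : ∀ z ∈ O, HasFDerivAt Γ (fderiv ℝ Γ z) z := fun z hz =>
    ((hΓ.contDiffAt (hO.mem_nhds hz)).differentiableAt (by simp)).hasFDerivAt
  have hdY : ∀ z ∈ O, ∀ v, fderiv ℝ (fun z => ev (Γ z)) z v = fderiv ℝ Γ z v 1 := by
    intro z hz v
    have h1 : HasFDerivAt (fun z => ev (Γ z)) (ev ∘L fderiv ℝ Γ z) z :=
      ev.hasFDerivAt.comp z (hdΓ z hz)
    rw [h1.fderiv]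
    rfl
  refine ⟨_, fun z => ev (Γ z), hO', ⟨hpO, ?_⟩, ev.contDiff.comp_contDiffOn
    (hΓ.mono inter_subset_left), ?_, fun v => ?_, fun z hz => ⟨hz.2 (mem_univ _), fun l => ?_⟩⟩
  · rw [mem_preimage, hΓ0]
    exact fun _ _ => hp
  · change ev (Γ (0, p)) = p
    rw [hΓ0]
    rfl
  · rw [hdY _ hpO, (h _ hpO).2, hΓ0]
    have h0 : constCurve E (0 : E) = 0 := map_zero _
    simp only [h0, map_zero, add_zero]
    rfl
  rw [hdY z hz.1]
  obtain ⟨h1, h2⟩ := h z hz.1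
  obtain ⟨k, y⟩ := z
  set γ := Γ (k, y)
  set η := fderiv ℝ Γ (k, y) (l, 0)
  set w₁ := curveApply I E E (superposition I ⟨A, hA.continuous⟩ γ) (constCurve E k)
  set w₂ := curveApply I E E (curveApply I _ _ (superposition I ⟨fderiv ℝ A, hA'c⟩ γ) η)
    (constCurve E k) + curveApply I E E (superposition I ⟨A, hA.continuous⟩ γ) (constCurve E l)
    with hw₂
  have h2' : η = integrateCurve E w₂ := by
    rw [hw₂, map_add, ← zero_add (_ + _), ← map_zero (constCurve E)]
    exact h2 (l, 0)
  let P : ℝ → E := fun t => y + ∫ s in (0 : ℝ)..t, IccExtend zero_le_one w₁ s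
  let Q : ℝ → E := fun t => ∫ s in (0 : ℝ)..t, IccExtend zero_le_one w₂ s
  have hP : ∀ t : I, P t = γ t := fun t => by
    conv_rhs => rw [h1]
    rfl
  have hQ : ∀ t : I, Q t = η t := fun t => by
    conv_rhs => rw [h2']
    rfl
  have hP' : ∀ t, HasDerivAt P (IccExtend zero_le_one w₁ t) t := fun t =>
    (hasDerivAt_integrateCurve w₁ t).const_add y
  have hQ' : ∀ t, HasDerivAt Q (IccExtend zero_le_one w₂ t) t := hasDerivAt_integrateCurve w₂
  -- `u` measures the failure of the claim along the curve; it solves a linear homogeneous ODE.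
  let u : ℝ → E := fun t => Q t - t • A (P t) l
  have hu' : ∀ t, HasDerivAt u (IccExtend zero_le_one w₂ t -
      (t • fderiv ℝ A (P t) (IccExtend zero_le_one w₁ t) l + (1 : ℝ) • A (P t) l)) t := fun t =>
    (hQ' t).sub ((hasDerivAt_id t).smul
      (((hdA (P t)).comp_hasDerivAt t (hP' t)).clm_apply (hasDerivAt_const t l) |>.congr_deriv
        (by simp)))
  have hPc : Continuous P := continuous_iff_continuousAt.2 fun t => (hP' t).continuousAt
  obtain ⟨K, hK⟩ : ∃ K, ∀ t ∈ Icc (0 : ℝ) 1, ‖fderiv ℝ A (P t)‖ ≤ K := by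
    have hn : Continuous fun t => ‖fderiv ℝ A (P t)‖ := 
      (continuous_norm (E := E →L[ℝ] E →L[ℝ] E)).comp (hA'c.comp hPc)
    obtain ⟨K, hK⟩ := isCompact_Icc.exists_bound_of_continuousOn (s := Icc (0 : ℝ) 1)
      hn.continuousOn
    exact ⟨K, fun t ht => (le_abs_self _).trans (hK t ht)⟩
  have hu : ∀ t ∈ Icc (0 : ℝ) 1, u t = 0 := by
    refine eq_zero_of_abs_deriv_le_mul_abs_self_of_eq_zero_right (K := K * ‖k‖)
      (fun t _ => (hu' t).continuousAt.continuousWithinAt)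
      (fun t _ => (hu' t).hasDerivWithinAt) (by simp [u, Q]) fun t ht => ?_
    have ht' : t ∈ Icc (0 : ℝ) 1 := Ico_subset_Icc_self ht
    have e1 : IccExtend zero_le_one w₁ t = A (P t) k := by
      rw [IccExtend_of_mem _ _ ht', hP ⟨t, ht'⟩]
      rfl
    have e2 : IccExtend zero_le_one w₂ t = fderiv ℝ A (P t) (Q t) k + A (P t) l := by
      rw [IccExtend_of_mem _ _ ht', hP ⟨t, ht'⟩, hQ ⟨t, ht'⟩]
      rfl
    have hPW : P t ∈ W := by
      rw [hP ⟨t, ht'⟩]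
      exact hz.2 (mem_univ _)
    have e3 : IccExtend zero_le_one w₂ t - (t • fderiv ℝ A (P t) (IccExtend zero_le_one w₁ t) l +
        (1 : ℝ) • A (P t) l) = fderiv ℝ A (P t) (u t) k := by
      rw [e1, e2, hcomm _ hPW]
      simp [u]
    rw [e3]
    calc ‖fderiv ℝ A (P t) (u t) k‖ ≤ ‖fderiv ℝ A (P t)‖ * ‖u t‖ * ‖k‖ :=
          (fderiv ℝ A (P t)).le_opNorm₂ _ _
      _ ≤ K * ‖u t‖ * ‖k‖ := by gcongr; exact hK t ht'
      _ = K * ‖k‖ * ‖u t‖ := by ring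
  have h3 := hu 1 ⟨zero_le_one, le_rfl⟩
  have hP1 : P 1 = γ 1 := hP 1
  have hQ1 : Q 1 = η 1 := hQ 1
  simp only [u, one_smul, hP1, hQ1] at h3
  exact sub_eq_zero.1 h3

end Flow

/-! ### First integrals of involutive Pfaffian systems -/

section Frobenius

open Set Filter Topology

/-- Multiplication by a bump function makes a smooth map on a neighbourhood of `p` globally smooth
without changing it near `p`. -/
theorem exists_contDiff_smul_of_contDiffOn {E V : Type*} [NormedAddCommGroup E] [NormedSpace ℝ E]
    [FiniteDimensional ℝ E] [NormedAddCommGroup V] [NormedSpace ℝ V] {W : Set E} (hW : IsOpen W)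
    {f : E → V} (hf : ContDiffOn ℝ ∞ f W) {p : E} (hp : p ∈ W) :
    ∃ (χ : E → ℝ) (W' : Set E), IsOpen W' ∧ p ∈ W' ∧ W' ⊆ W ∧ (∀ x ∈ W', χ x = 1) ∧
      (∀ x ∉ W, χ x = 0) ∧ ContDiff ℝ ∞ (fun x => χ x • f x) := by
  obtain ⟨r, hr, hrW⟩ := Metric.isOpen_iff.1 hW p hp
  let χ : ContDiffBump p := ⟨r / 4, r / 2, by positivity, by linarith⟩
  have hsupp : tsupport χ ⊆ W := by
    rw [χ.tsupport_eq]
    exact (Metric.closedBall_subset_ball (by change r / 2 < r; linarith)).trans hrW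
  refine ⟨χ, Metric.ball p (r / 4), Metric.isOpen_ball, Metric.mem_ball_self (by positivity),
    (Metric.ball_subset_ball (by linarith)).trans hrW,
    fun x hx => χ.one_of_mem_closedBall (Metric.ball_subset_closedBall hx),
    fun x hx => image_eq_zero_of_notMem_tsupport fun h => hx (hsupp h), ?_⟩
  rw [contDiff_iff_contDiffAt]
  intro x
  by_cases hx : x ∈ tsupport χ
  · exact χ.contDiff.contDiffAt.smul (hf.contDiffAt (hW.mem_nhds (hsupp hx)))
  · refine (contDiffAt_const (c := (0 : V))).congr_of_eventuallyEq ?_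
    filter_upwards [(isClosed_tsupport χ).isOpen_compl.mem_nhds hx] with y hy
    rw [image_eq_zero_of_notMem_tsupport hy, zero_smul]

/-- **Frobenius theorem** for the kernel of a vector-valued one-form `θ`, surjective at `p`: if the
vector fields with values in `ker θ` are closed under brackets, there are as many independent
functions near `p` as `θ` has components whose differentials vanish on `ker θ`.

With a right inverse `R` of `θ p` and the projections `π x = 1 - R (θ x R)⁻¹ θ x` onto `ker (θ x)`,
the vector fields `x ↦ π x k`, `k ∈ ker (θ p)`, commute, and their flows, applied to the transversal
`p + R F`, straighten `ker θ`. -/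
theorem exists_first_integrals {E F : Type} [NormedAddCommGroup E] [NormedSpace ℝ E]
    [FiniteDimensional ℝ E] [NormedAddCommGroup F] [NormedSpace ℝ F] [FiniteDimensional ℝ F]
    {W : Set E} (hW : IsOpen W) {θ : E → E →L[ℝ] F} (hθ : ContDiffOn ℝ ∞ θ W) {p : E} (hp : p ∈ W)
    (hsurj : Function.Surjective (θ p))
    (hinv : ∀ (X Y : E → E) (W' : Set E), IsOpen W' → W' ⊆ W → ContDiffOn ℝ ∞ X W' →
      ContDiffOn ℝ ∞ Y W' → (∀ x ∈ W', θ x (X x) = 0) → (∀ x ∈ W', θ x (Y x) = 0) →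
      ∀ x ∈ W', θ x (VectorField.lieBracket ℝ X Y x) = 0) :
    ∃ (W' : Set E) (h : E → F), IsOpen W' ∧ p ∈ W' ∧ W' ⊆ W ∧ ContDiffOn ℝ ∞ h W' ∧
      ∀ x ∈ W', Function.Surjective (fderiv ℝ h x) ∧ ∀ v, θ x v = 0 → fderiv ℝ h x v = 0 := by
  have : CompleteSpace E := FiniteDimensional.complete ℝ E
  have : CompleteSpace F := FiniteDimensional.complete ℝ F
  obtain ⟨R₀, hR₀⟩ := (θ p : E →ₗ[ℝ] F).exists_rightInverse_of_surjective
    (LinearMap.range_eq_top.2 hsurj)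
  let R : F →L[ℝ] E := LinearMap.toContinuousLinearMap R₀
  have hR : ∀ y, θ p (R y) = y := fun y => LinearMap.congr_fun hR₀ y
  let β : E → F →L[ℝ] F := fun x => θ x ∘L R
  have hβ : ContDiffOn ℝ ∞ β W := hθ.clm_comp contDiffOn_const
  have hβp : β p = 1 := ContinuousLinearMap.ext hR
  let W₁ : Set E := W ∩ β ⁻¹' {b | IsUnit b}
  have hW₁ : IsOpen W₁ := hβ.continuousOn.isOpen_inter_preimage hW Units.isOpen
  have hpW₁ : p ∈ W₁ := ⟨hp, by simp [hβp]⟩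
  let π : E → E →L[ℝ] E := fun x => 1 - R ∘L Ring.inverse (β x) ∘L θ x
  have hθπ : ∀ x ∈ W₁, ∀ v, θ x (π x v) = 0 := by
    intro x hx v
    have h1 : β x (Ring.inverse (β x) (θ x v)) = θ x v :=
      congrArg (fun b : F →L[ℝ] F => b (θ x v)) (Ring.mul_inverse_cancel _ hx.2)
    change θ x (v - R (Ring.inverse (β x) (θ x v))) = 0
    rw [map_sub, sub_eq_zero]
    exact h1.symm
  have hπR : ∀ x ∈ W₁, ∀ y, π x (R y) = 0 := by
    intro x hx y
    have h1 : Ring.inverse (β x) (β x y) = y :=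
      congrArg (fun b : F →L[ℝ] F => b y) (Ring.inverse_mul_cancel _ hx.2)
    change R y - R (Ring.inverse (β x) (β x y)) = 0
    rw [h1, sub_self]
  have hπker : ∀ x v, θ x v = 0 → π x v = v := by
    intro x v hv
    change v - R (Ring.inverse (β x) (θ x v)) = v
    simp [hv]
  have hπp : ∀ v, π p v = v - R (θ p v) := by
    intro v
    change v - R (Ring.inverse (β p) (θ p v)) = _
    rw [hβp, Ring.inverse_one]
    rfl
  have hπc : ContDiffOn ℝ ∞ π W₁ := by
    have h1 : ContDiffOn ℝ ∞ (fun x => Ring.inverse (β x)) W₁ := by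
      intro x hx
      obtain ⟨u, hu⟩ := hx.2
      refine ContDiffAt.comp_contDiffWithinAt x (g := Ring.inverse) ?_
        ((hβ.mono inter_subset_left) x hx)
      rw [← hu]
      exact contDiffAt_ringInverse ℝ u
    exact contDiffOn_const.sub
      (contDiffOn_const.clm_comp (h1.clm_comp (hθ.mono inter_subset_left)))
  let A₀ : E → E →L[ℝ] E := fun x => π x ∘L π p
  have hA₀ : ContDiffOn ℝ ∞ A₀ W₁ := hπc.clm_comp contDiffOn_const
  obtain ⟨χ, W₂, hW₂, hpW₂, hW₂₁, hχ1, -, hA⟩ := exists_contDiff_smul_of_contDiffOn hW₁ hA₀ hpW₁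
  set A : E → E →L[ℝ] E := fun x => χ x • A₀ x
  have hAA₀ : ∀ x ∈ W₂, A x = A₀ x := fun x hx => by simp only [A, hχ1 x hx, one_smul]
  have hcomm : ∀ x ∈ W₂, ∀ k l, fderiv ℝ A x (A x k) l = fderiv ℝ A x (A x l) k := by
    intro x hx k l
    have hd : ∀ m, HasFDerivAt (fun y => A y m) ((fderiv ℝ A x).flip m) x := fun m =>
      ((hA.differentiable (by simp) x).hasFDerivAt).clm_apply (hasFDerivAt_const m x)
        |>.congr_fderiv (by ext; simp)
    have hX : ∀ m, ContDiffOn ℝ ∞ (fun y => A y m) W₂ := fun m =>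
      (hA.clm_apply contDiff_const).contDiffOn
    have h0 := hinv (fun y => A y k) (fun y => A y l) W₂ hW₂ (hW₂₁.trans inter_subset_left)
      (hX k) (hX l) (fun y hy => by rw [hAA₀ y hy]; exact hθπ y (hW₂₁ hy) _)
      (fun y hy => by rw [hAA₀ y hy]; exact hθπ y (hW₂₁ hy) _) x hx
    have h1 : ∀ m v, π p (fderiv ℝ A x v m) = 0 := by
      intro m v
      have h2 : HasFDerivAt (fun y => π p (A y m)) (π p ∘L (fderiv ℝ A x).flip m) x :=
        (π p).hasFDerivAt.comp x (hd m)
      have h3 : (fun y => π p (A y m)) =ᶠ[𝓝 x] fun _ => π p (π p m) := by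
        filter_upwards [hW₂.mem_nhds hx] with y hy
        rw [hAA₀ y hy]
        change π p (π p m - R _) = _
        rw [map_sub, hπR p hpW₁, sub_zero]
      exact congrArg (fun T : E →L[ℝ] E => T v)
        (h2.unique ((hasFDerivAt_const _ x).congr_of_eventuallyEq h3))
    rw [VectorField.lieBracket, (hd l).fderiv, (hd k).fderiv] at h0
    simp only [ContinuousLinearMap.flip_apply] at h0
    set z := fderiv ℝ A x (A x k) l - fderiv ℝ A x (A x l) k with hz
    have h4 : z = R (θ p z) := by
      have : π p z = 0 := by rw [hz, map_sub, h1, h1, sub_zero]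
      rw [hπp] at this
      exact sub_eq_zero.1 this
    have h5 : z = 0 := by
      rw [← hπker x z h0, h4]
      exact hπR x (hW₂₁ hx) _
    exact sub_eq_zero.1 h5
  obtain ⟨O, Y, hO, hpO, hY, hY0, hY2, hY1⟩ := exists_commuting_flow A hA hW₂ hpW₂ hcomm
  let j : E → E × E := fun e => (π p e, p + R (θ p e))
  have hj : ContDiff ℝ ∞ j := by fun_prop
  let j' : E →L[ℝ] E × E := (π p).prod (R ∘L θ p)
  have hdj : ∀ e, HasFDerivAt j j' e := fun e =>
    (π p).hasFDerivAt.prodMk ((R ∘L θ p).hasFDerivAt.const_add p)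
  have hj0 : j 0 = (0, p) := by simp [j]
  let OG : Set E := j ⁻¹' O
  have hOG : IsOpen OG := hO.preimage hj.continuous
  have h0OG : (0 : E) ∈ OG := by
    change j 0 ∈ O
    rwa [hj0]
  have hdY : ∀ z ∈ O, HasFDerivAt Y (fderiv ℝ Y z) z := fun z hz =>
    ((hY.contDiffAt (hO.mem_nhds hz)).differentiableAt (by simp)).hasFDerivAt
  let G : E → E := fun e => Y (j e)
  have hG : ContDiffOn ℝ ∞ G OG := hY.comp hj.contDiffOn fun e he => he
  have hdG : ∀ e ∈ OG, HasFDerivAt G (fderiv ℝ Y (j e) ∘L j') e := fun e he =>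
    (hdY _ he).comp e (hdj e)
  have hsplit : ∀ e v, fderiv ℝ Y (j e) (j' v) =
      fderiv ℝ Y (j e) (π p v, 0) + fderiv ℝ Y (j e) (0, R (θ p v)) := fun e v => by
    rw [← map_add]
    simp [j']
  have hG0 : fderiv ℝ G 0 = (ContinuousLinearEquiv.refl ℝ E : E →L[ℝ] E) := by
    rw [(hdG 0 h0OG).fderiv]
    ext v
    change fderiv ℝ Y (j 0) (j' v) = v
    rw [hsplit, hj0, (hY1 _ hpO).2, hY2, hY0, hAA₀ p hpW₂]
    have h1 : ∀ v, π p (π p v) = π p v := fun v => hπker p _ (hθπ p hpW₁ v)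
    change π p (π p (π p v)) + _ = v
    rw [h1, h1, hπp, sub_add_cancel]
  obtain ⟨φ, hφ, h0φ, hφs, hφsymm⟩ := exists_openPartialHomeomorph_contDiffOn hOG hG h0OG _ hG0
  have hφ2 : ∀ x ∈ φ.target, Y (j (φ.symm x)) = x := fun x hx => by
    have := φ.right_inv hx
    rwa [hφ] at this
  have hpx : φ 0 = p := by
    rw [hφ]
    change Y (j 0) = p
    rw [hj0, hY0]
  refine ⟨φ.target, fun x => θ p (φ.symm x), φ.open_target, ?_, ?_,
    (θ p).contDiff.comp_contDiffOn hφsymm, ?_⟩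
  · rw [← hpx]
    exact φ.map_source h0φ
  · intro x hx
    rw [← hφ2 x hx]
    exact (hW₂₁ (hY1 _ (hφs (φ.map_target hx))).1).1
  · intro x hx
    set e := φ.symm x with he
    have hes : e ∈ φ.source := φ.map_target hx
    have hxe : G e = x := hφ2 x hx
    have hxW : x ∈ W₂ := by
      rw [← hφ2 x hx]
      exact (hY1 _ (hφs hes)).1
    have hdh : HasFDerivAt (fun x => θ p (φ.symm x)) (fderiv ℝ (fun x => θ p (φ.symm x)) x) x :=
      ((((θ p).contDiff.comp_contDiffOn hφsymm).contDiffAt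
        (φ.open_target.mem_nhds hx)).differentiableAt (by simp)).hasFDerivAt
    set D := fderiv ℝ (fun x => θ p (φ.symm x)) x
    have hDG : ∀ v, D (fderiv ℝ Y (j e) (j' v)) = θ p v := by
      intro v
      have h1 : HasFDerivAt (fun e => θ p (φ.symm (G e))) (D ∘L (fderiv ℝ Y (j e) ∘L j')) e := by
        rw [← hxe] at hdh
        exact hdh.comp e (hdG e (hφs hes))
      have h2 : (fun e => θ p (φ.symm (G e))) =ᶠ[𝓝 e] fun e => θ p e := by
        filter_upwards [φ.open_source.mem_nhds hes] with y hy
        rw [← hφ, φ.left_inv hy]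
      exact congrArg (fun T : E →L[ℝ] F => T v)
        (h1.unique ((θ p).hasFDerivAt.congr_of_eventuallyEq h2))
    refine ⟨fun y => ?_, fun v hv => ?_⟩
    · obtain ⟨v, rfl⟩ := hsurj y
      exact ⟨_, hDG v⟩
    · have hθv : θ p (π p v) = 0 := hθπ p hpW₁ v
      have h1 := hDG (π p v)
      rw [hsplit, hθv, map_zero] at h1
      have h2 : fderiv ℝ Y (j e) (π p (π p v), 0) = v := by
        rw [(hY1 _ (hφs hes)).2, hφ2 x hx, hAA₀ x hxW]
        change π x (π p (π p (π p v))) = v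
        rw [hπker p _ (hθπ p hpW₁ _), hπker p _ (hθπ p hpW₁ _), hπp, map_sub,
          hπR x (hW₂₁ hxW), sub_zero, hπker x v hv]
      have h3 : ((0 : E), (0 : E)) = 0 := rfl
      rwa [h2, h3, map_zero, add_zero] at h1

end Frobenius

/-! ### Brackets, one-forms and the derived flag -/

section Flag

open Set Filter Topology VectorField

variable {n : ℕ}

theorem minSmoothness_two_le_infty : minSmoothness ℝ 2 ≤ ∞ := by
  rw [minSmoothness_of_isRCLikeNormedField]
  exact WithTop.coe_le_coe.2 (le_top : (2 : ℕ∞) ≤ ⊤)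

theorem ContDiffOn.lieBracket_of_isOpen {W : Set (State n)} (hW : IsOpen W) {X Y : VecField n}
    (hX : ContDiffOn ℝ ∞ X W) (hY : ContDiffOn ℝ ∞ Y W) :
    ContDiffOn ℝ ∞ (lieBracket ℝ X Y) W := fun x hx =>
  ((hX.contDiffAt (hW.mem_nhds hx)).lieBracket_vectorField (hY.contDiffAt (hW.mem_nhds hx))
    (by simp)).contDiffWithinAt

theorem ContDiffOn.differentiableAt_of_isOpen {E F : Type*} [NormedAddCommGroup E]
    [NormedSpace ℝ E] [NormedAddCommGroup F] [NormedSpace ℝ F] {W : Set E} {f : E → F}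
    (hf : ContDiffOn ℝ ∞ f W) (hW : IsOpen W) {x : E} (hx : x ∈ W) : DifferentiableAt ℝ f x :=
  (hf.contDiffAt (hW.mem_nhds hx)).differentiableAt (by simp)

theorem ContDiffOn.fderiv_infty_of_isOpen {E F : Type*} [NormedAddCommGroup E]
    [NormedSpace ℝ E] [NormedAddCommGroup F] [NormedSpace ℝ F] {W : Set E} {f : E → F}
    (hf : ContDiffOn ℝ ∞ f W) (hW : IsOpen W) : ContDiffOn ℝ ∞ (fderiv ℝ f) W :=
  hf.fderiv_of_isOpen hW (by simp)

theorem contDiffOn_of_mem_span {U : Set (State n)} {S : Set (VecField n)}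
    (hS : ∀ X ∈ S, ContDiffOn ℝ ∞ X U) {X : VecField n}
    (hX : X ∈ Submodule.span (smoothFun U) S) : ContDiffOn ℝ ∞ X U := by
  induction hX using Submodule.span_induction with
  | mem X hX => exact hS X hX
  | zero => exact contDiffOn_const
  | add X Y _ _ hX hY => exact hX.add hY
  | smul a X _ hX => exact ContDiffOn.smul a.2 hX

theorem contDiffOn_of_mem_controlFlag {U : Set (State n)} (hU : IsOpen U) {g₁ g₂ : VecField n}
    (hg₁ : ContDiffOn ℝ ∞ g₁ U) (hg₂ : ContDiffOn ℝ ∞ g₂ U) (k : ℕ) {X : VecField n}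
    (hX : X ∈ controlFlag U g₁ g₂ k) : ContDiffOn ℝ ∞ X U := by
  induction k generalizing X with
  | zero =>
    refine contDiffOn_of_mem_span ?_ hX
    rintro _ (rfl | rfl)
    exacts [hg₁, hg₂]
  | succ k ih =>
    obtain ⟨Y, hY, Z, hZ, rfl⟩ := Submodule.mem_sup.1 hX
    refine (ih hY).add (contDiffOn_of_mem_span ?_ hZ)
    rintro _ ⟨A, hA, B, hB, rfl⟩
    exact (ih hA).lieBracket_of_isOpen hU (ih hB)

theorem controlFlag_mono {U : Set (State n)} {g₁ g₂ : VecField n} :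
    Monotone (controlFlag U g₁ g₂) :=
  monotone_nat_of_le_succ fun _ => le_sup_left

theorem lieBracket_mem_controlFlag {U : Set (State n)} {g₁ g₂ : VecField n} {k : ℕ}
    {X Y : VecField n} (hX : X ∈ controlFlag U g₁ g₂ k) (hY : Y ∈ controlFlag U g₁ g₂ k) :
    lieBracket ℝ X Y ∈ controlFlag U g₁ g₂ (k + 1) :=
  Submodule.mem_sup_right (Submodule.subset_span ⟨X, hX, Y, hY, rfl⟩)

/-- A subspace that contains the values at `q` of the vector fields in `G_k` and of their brackets
contains `G_{k+1}(q)`. -/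
theorem controlFlag_succ_atPoint_le {U : Set (State n)} {g₁ g₂ : VecField n} {k : ℕ} {q : State n}
    {S : Submodule ℝ (State n)} (h : ∀ X ∈ controlFlag U g₁ g₂ k, X q ∈ S)
    (hb : ∀ X ∈ controlFlag U g₁ g₂ k, ∀ Y ∈ controlFlag U g₁ g₂ k, lieBracket ℝ X Y q ∈ S) :
    (controlFlag U g₁ g₂ (k + 1)).atPoint q ≤ S := by
  rintro _ ⟨X, hX, rfl⟩
  obtain ⟨Y, hY, Z, hZ, rfl⟩ := Submodule.mem_sup.1 hX
  refine S.add_mem (h Y hY) ?_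
  clear hX
  induction hZ using Submodule.span_induction with
  | mem X hX =>
    obtain ⟨A, hA, B, hB, rfl⟩ := hX
    exact hb A hA B hB
  | zero => exact S.zero_mem
  | add X Y _ _ hX hY => exact S.add_mem hX hY
  | smul a X _ hX => exact S.smul_mem _ hX

theorem contractExtDeriv_swap (θ : OneForm n) (q X Y : State n) :
    contractExtDeriv θ q X Y = -contractExtDeriv θ q Y X := by
  rw [contractExtDeriv_apply, contractExtDeriv_apply, neg_sub]

/-- `θ([X, Y]) = -dθ(X, Y)` for vector fields `X`, `Y` in the kernel of `θ`. -/
theorem apply_lieBracket_eq_neg_contractExtDeriv {θ : OneForm n} {X Y : VecField n} {q : State n}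
    (hθ : DifferentiableAt ℝ θ q) (hX : DifferentiableAt ℝ X q) (hY : DifferentiableAt ℝ Y q)
    (hθX : ∀ᶠ x in 𝓝 q, θ x (X x) = 0) (hθY : ∀ᶠ x in 𝓝 q, θ x (Y x) = 0) :
    θ q (lieBracket ℝ X Y q) = -contractExtDeriv θ q (X q) (Y q) := by
  have key : ∀ {Z : VecField n}, DifferentiableAt ℝ Z q → (∀ᶠ x in 𝓝 q, θ x (Z x) = 0) →
      ∀ v, θ q (fderiv ℝ Z q v) + fderiv ℝ θ q v (Z q) = 0 := by
    intro Z hZ h0 v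
    have h1 := hθ.hasFDerivAt.clm_apply hZ.hasFDerivAt
    have h2 := h1.unique ((hasFDerivAt_const (0 : ℝ) q).congr_of_eventuallyEq h0)
    simpa using congrArg (fun T : State n →L[ℝ] ℝ => T v) h2
  have h1 := key hY hθY (X q)
  have h2 := key hX hθX (Y q)
  rw [lieBracket, map_sub, contractExtDeriv_apply]
  linarith

/-- Exact one-forms are closed, in the form needed here: brackets preserve the kernel of `da`. -/
theorem fderiv_apply_lieBracket_eq_zero {W : Set (State n)} (hW : IsOpen W) {a : State n → ℝ}
    (ha : ContDiffOn ℝ ∞ a W) {X Y : VecField n} (hX : ContDiffOn ℝ ∞ X W)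
    (hY : ContDiffOn ℝ ∞ Y W) (haX : ∀ x ∈ W, fderiv ℝ a x (X x) = 0)
    (haY : ∀ x ∈ W, fderiv ℝ a x (Y x) = 0) {q : State n} (hq : q ∈ W) :
    fderiv ℝ a q (lieBracket ℝ X Y q) = 0 := by
  have h0 : ∀ {Z : VecField n}, (∀ x ∈ W, fderiv ℝ a x (Z x) = 0) →
      fderiv ℝ (fun x => fderiv ℝ a x (Z x)) q = 0 := fun hZ => by
    have : (fun x => fderiv ℝ a x _) =ᶠ[𝓝 q] fun _ => (0 : ℝ) :=
      eventually_of_mem (hW.mem_nhds hq) hZ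
    rw [this.fderiv_eq, fderiv_fun_const]
    rfl
  rw [fderiv_apply_lieBracket (ha.contDiffAt (hW.mem_nhds hq)) minSmoothness_two_le_infty
    (hY.differentiableAt_of_isOpen hW hq) (hX.differentiableAt_of_isOpen hW hq), h0 haX, h0 haY]
  simp

/-- `d(da - b dc) = -db ∧ dc`. -/
theorem contractExtDeriv_sub_smul {W : Set (State n)} (hW : IsOpen W) {a b c : State n → ℝ}
    (ha : ContDiffOn ℝ ∞ a W) (hb : ContDiffOn ℝ ∞ b W) (hc : ContDiffOn ℝ ∞ c W) {q : State n}
    (hq : q ∈ W) (X Y : State n) :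
    contractExtDeriv (fun x => fderiv ℝ a x - b x • fderiv ℝ c x) q X Y =
      -(fderiv ℝ b q X * fderiv ℝ c q Y - fderiv ℝ b q Y * fderiv ℝ c q X) := by
  have hsa : IsSymmSndFDerivAt ℝ a q :=
    (ha.contDiffAt (hW.mem_nhds hq)).isSymmSndFDerivAt minSmoothness_two_le_infty
  have hsc : IsSymmSndFDerivAt ℝ c q :=
    (hc.contDiffAt (hW.mem_nhds hq)).isSymmSndFDerivAt minSmoothness_two_le_infty
  have hda := ((ha.fderiv_infty_of_isOpen hW).differentiableAt_of_isOpen hW hq).hasFDerivAt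
  have hdc := ((hc.fderiv_infty_of_isOpen hW).differentiableAt_of_isOpen hW hq).hasFDerivAt
  have hdb := (hb.differentiableAt_of_isOpen hW hq).hasFDerivAt
  have hd : HasFDerivAt (fun x => fderiv ℝ a x - b x • fderiv ℝ c x) _ q :=
    hda.sub (hdb.smul hdc)
  rw [contractExtDeriv_apply, hd.fderiv]
  simp only [sub_apply, add_apply,
    smul_apply, ContinuousLinearMap.smulRight_apply, smul_eq_mul]
  rw [hsa.eq X Y, hsc.eq X Y]
  ring

/-- The one-form `Y ⌟ dθ` is smooth if `θ` and `Y` are. -/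
theorem contDiffOn_contractExtDeriv {W : Set (State n)} (hW : IsOpen W) {θ : OneForm n}
    (hθ : ContDiffOn ℝ ∞ θ W) {Y : VecField n} (hY : ContDiffOn ℝ ∞ Y W) :
    ContDiffOn ℝ ∞ (fun x => contractExtDeriv θ x (Y x)) W := by
  have hd := hθ.fderiv_infty_of_isOpen hW
  rw [contDiffOn_clm_apply]
  intro v
  simp only [contractExtDeriv_apply]
  exact ((hd.clm_apply hY).clm_apply contDiffOn_const).sub
    ((hd.clm_apply contDiffOn_const).clm_apply hY)

end Flag

/-! ### Linear algebra of pairs of functionals and of two-forms -/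

section LinearAlgebra

open Module

/-- A linear map onto `ℝ^k` with `k ≥ 2` does not factor through a functional. -/
theorem exists_apply_ne_zero_of_surjective {E : Type*} [AddCommGroup E] [Module ℝ E] {k : ℕ}
    {L : E →ₗ[ℝ] Fin (k + 2) → ℝ} (hL : Function.Surjective L) (l : E →ₗ[ℝ] ℝ) :
    ∃ v i, l v = 0 ∧ L v i ≠ 0 := by
  by_contra! h
  obtain ⟨v₀, h₀⟩ := hL (Pi.single 0 1)
  obtain ⟨v₁, h₁⟩ := hL (Pi.single 1 1)
  have h2 := h (l v₁ • v₀ - l v₀ • v₁)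
  have h3 : l (l v₁ • v₀ - l v₀ • v₁) = 0 := by
    simp only [map_sub, map_smul, smul_eq_mul]
    ring
  have h4 : l v₁ = 0 := by simpa [h₀, h₁] using h2 0 h3
  simpa [h₁] using h v₁ 1 h4

theorem finrank_inf_ker_add_two_le {E : Type*} [AddCommGroup E] [Module ℝ E]
    [FiniteDimensional ℝ E] (a b : E →ₗ[ℝ] ℝ) (u v : E) (h : a u * b v - a v * b u ≠ 0) :
    finrank ℝ ↥(LinearMap.ker a ⊓ LinearMap.ker b) + 2 ≤ finrank ℝ E := by
  have h1 : finrank ℝ ↥(LinearMap.ker a) + 1 ≤ finrank ℝ E := by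
    have : LinearMap.ker a < ⊤ := by
      refine lt_top_iff_ne_top.2 fun ht => h ?_
      have ha : a = 0 := LinearMap.ker_eq_top.1 ht
      simp [ha]
    simpa using Submodule.finrank_lt_finrank_of_lt this
  have h2 : LinearMap.ker a ⊓ LinearMap.ker b < LinearMap.ker a := by
    refine lt_of_le_of_ne inf_le_left fun he => h ?_
    have h3 : a u • v - a v • u ∈ LinearMap.ker a := by
      simp only [LinearMap.mem_ker, map_sub, map_smul, smul_eq_mul]
      ring
    rw [← he] at h3
    simpa using h3.2
  have := Submodule.finrank_lt_finrank_of_lt h2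
  omega

/-- If an alternating form on `H` vanishes on a subspace `K ≤ H` of codimension at most one, then
it has rank at most two: vectors orthogonal to a pair `Y₁`, `Y₂` on which it does not vanish are in
its kernel. -/
theorem apply_eq_zero_of_isotropic {E : Type*} [AddCommGroup E] [Module ℝ E]
    [FiniteDimensional ℝ E] (B : E →ₗ[ℝ] E →ₗ[ℝ] ℝ) (hB : ∀ x y, B x y = -B y x)
    {K H : Submodule ℝ E} (hKH : K ≤ H) (hr : finrank ℝ H ≤ finrank ℝ K + 1)
    (hK : ∀ x ∈ K, ∀ y ∈ K, B x y = 0) {Y₁ Y₂ X Z : E} (h₁ : Y₁ ∈ H) (h₂ : Y₂ ∈ H) (hX : X ∈ H)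
    (hZ : Z ∈ H) (h₁₂ : B Y₁ Y₂ ≠ 0) (hX₁ : B X Y₁ = 0) (hX₂ : B X Y₂ = 0) : B X Z = 0 := by
  obtain ⟨e, he⟩ : ∃ e, ∀ h ∈ H, ∃ c : ℝ, h - c • e ∈ K := by
    by_cases hHK : H ≤ K
    · exact ⟨0, fun h hh => ⟨0, by simpa using hHK hh⟩⟩
    · obtain ⟨e, heH, heK⟩ := Set.not_subset.1 hHK
      have h3 : K < K ⊔ Submodule.span ℝ {e} := by
        refine lt_of_le_of_ne le_sup_left fun h => heK ?_
        rw [h]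
        exact Submodule.mem_sup_right (Submodule.mem_span_singleton_self e)
      have h4 : K ⊔ Submodule.span ℝ {e} = H := by
        refine Submodule.eq_of_le_of_finrank_le
          (sup_le hKH (by simpa [Submodule.span_le] using heH)) ?_
        have := Submodule.finrank_lt_finrank_of_lt h3
        omega
      refine ⟨e, fun h hh => ?_⟩
      rw [← h4] at hh
      obtain ⟨k, hk, y, hy, rfl⟩ := Submodule.mem_sup.1 hh
      obtain ⟨c, rfl⟩ := Submodule.mem_span_singleton.1 hy
      exact ⟨c, by simpa using hk⟩
  have hee : B e e = 0 := by linarith [hB e e]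
  -- In terms of the coordinate `c` along `e` and of `b = B(·, e)`, the form is `b ∧ c` up to sign.
  have key : ∀ h ∈ H, ∀ h' ∈ H, ∀ c c' : ℝ, h - c • e ∈ K → h' - c' • e ∈ K →
      B h h' = c' * B h e - c * B h' e := by
    intro h _ h' _ c c' hc hc'
    have := hK _ hc _ hc'
    simp only [map_sub, map_smul, LinearMap.sub_apply, LinearMap.smul_apply, smul_eq_mul, hee,
      hB e h'] at this
    linarith
  obtain ⟨x, hx⟩ := he X hX
  obtain ⟨y₁, hy₁⟩ := he Y₁ h₁
  obtain ⟨y₂, hy₂⟩ := he Y₂ h₂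
  obtain ⟨z, hz⟩ := he Z hZ
  rw [key _ hX _ hZ x z hx hz]
  rw [key _ hX _ h₁ x y₁ hx hy₁] at hX₁
  rw [key _ hX _ h₂ x y₂ hx hy₂] at hX₂
  rw [key _ h₁ _ h₂ y₁ y₂ hy₁ hy₂] at h₁₂
  have hbX : B X e = 0 := by
    refine (mul_eq_zero.1 ?_).resolve_left h₁₂
    linear_combination B Y₁ e * hX₂ - B Y₂ e * hX₁
  have hcX : x = 0 := by
    refine (mul_eq_zero.1 ?_).resolve_left h₁₂
    linear_combination y₁ * hX₂ - y₂ * hX₁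
  simp [hbX, hcX]

end LinearAlgebra

/-! ### The Pfaff normal form of a one-form of class three -/

section Pfaff

open Set Filter Topology VectorField Module

variable {n : ℕ}

/-- A distribution of constant corank one is locally the kernel of a smooth one-form. -/
theorem exists_annihilating_form {U W : Set (State n)} (hW : IsOpen W)
    (H : VecDistribution U) (hH : ∀ X ∈ H, ContDiffOn ℝ ∞ X W)
    (hr : ∀ x ∈ W, finrank ℝ (H.atPoint x) + 1 = n) {p : State n} (hp : p ∈ W) :
    ∃ (W' : Set (State n)) (θ : OneForm n), IsOpen W' ∧ p ∈ W' ∧ W' ⊆ W ∧ ContDiffOn ℝ ∞ θ W' ∧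
      ∀ x ∈ W', ∀ v, θ x v = 0 ↔ v ∈ H.atPoint x := by
  obtain ⟨m, rfl⟩ : ∃ m, n = m + 1 := ⟨_, (hr p hp).symm⟩
  have hm : finrank ℝ (H.atPoint p) = m := by have := hr p hp; omega
  let b := finBasisOfFinrankEq ℝ (H.atPoint p) hm
  choose X hXH hXp using fun i => (b i).2
  obtain ⟨e, he⟩ : ∃ e, e ∉ H.atPoint p := by
    by_contra! h
    have h1 : H.atPoint p = ⊤ := Submodule.eq_top_iff'.2 h
    rw [h1, finrank_top, finrank_fin_fun] at hm
    omega
  -- The frame `X₁, …, Xₘ, e`, as a map from `ℝᵐ × ℝ`; the form is the last dual coordinate.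
  let A : State (m + 1) → ((Fin m → ℝ) × ℝ) →L[ℝ] State (m + 1) := fun x =>
    (∑ i, ((ContinuousLinearMap.proj (R := ℝ) (φ := fun _ : Fin m => ℝ) i) ∘L
      ContinuousLinearMap.fst ℝ (Fin m → ℝ) ℝ).smulRight (X i x)) +
    (ContinuousLinearMap.snd ℝ (Fin m → ℝ) ℝ).smulRight e
  have hAapp : ∀ x c, A x c = ∑ i, c.1 i • X i x + c.2 • e := by
    intro x c
    simp [A]
  have hA : ContDiffOn ℝ ∞ A W := by
    rw [contDiffOn_clm_apply]
    intro c
    simp only [hAapp]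
    exact (ContDiffOn.sum fun i _ =>
      (contDiffOn_const (c := c.1 i)).smul (hH _ (hXH i))).add contDiffOn_const
  have hinj : Function.Injective (A p) := by
    rw [injective_iff_map_eq_zero]
    intro c hc
    rw [hAapp] at hc
    simp only [hXp] at hc
    have h2 : c.2 = 0 := by
      by_contra h
      refine he ?_
      have h3 : c.2 • e ∈ H.atPoint p := by
        rw [eq_neg_of_add_eq_zero_right hc]
        exact (H.atPoint p).neg_mem (Submodule.sum_mem _ fun i _ =>
          Submodule.smul_mem _ _ (b i).2)
      simpa [smul_smul, inv_mul_cancel₀ h] using (H.atPoint p).smul_mem (c.2)⁻¹ h3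
    have h1 : c.1 = 0 := by
      rw [h2, zero_smul, add_zero] at hc
      have h3 : ∑ i, c.1 i • b i = 0 := by
        apply Subtype.ext
        simpa using hc
      funext i
      exact Fintype.linearIndependent_iff.1 b.linearIndependent c.1 h3 i
    exact Prod.ext h1 h2
  let e₀ : ((Fin m → ℝ) × ℝ) ≃L[ℝ] State (m + 1) :=
    (LinearMap.linearEquivOfInjective (A p : ((Fin m → ℝ) × ℝ) →ₗ[ℝ] State (m + 1)) hinj
      (by simp)).toContinuousLinearEquiv
  have he₀ : A p = e₀ := ContinuousLinearMap.ext fun _ => rfl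
  let W' : Set (State (m + 1)) :=
    W ∩ A ⁻¹' range ((↑) : (((Fin m → ℝ) × ℝ) ≃L[ℝ] State (m + 1)) → _ →L[ℝ] _)
  refine ⟨W', fun x => ContinuousLinearMap.snd ℝ (Fin m → ℝ) ℝ ∘L (A x).inverse,
    hA.continuousOn.isOpen_inter_preimage hW ContinuousLinearEquiv.isOpen, ⟨hp, e₀, he₀.symm⟩,
    inter_subset_left, ?_, ?_⟩
  · refine contDiffOn_const.clm_comp fun x hx => ?_
    obtain ⟨e', he'⟩ := hx.2
    refine ContDiffAt.comp_contDiffWithinAt x (g := ContinuousLinearMap.inverse) ?_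
      ((hA.mono inter_subset_left) x hx)
    rw [← he']
    exact contDiffAt_map_inverse e'
  · intro x hx
    obtain ⟨e', he'⟩ := hx.2
    have hval : ∀ v, (ContinuousLinearMap.snd ℝ (Fin m → ℝ) ℝ ∘L (A x).inverse) v =
        (e'.symm v).2 := by
      intro v
      rw [← he', ContinuousLinearMap.inverse_equiv]
      rfl
    set θ := ContinuousLinearMap.snd ℝ (Fin m → ℝ) ℝ ∘L (A x).inverse
    have hle : LinearMap.ker (θ : State (m + 1) →ₗ[ℝ] ℝ) ≤ H.atPoint x := by
      intro v hv
      have h0 : (e'.symm v).2 = 0 := by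
        rw [← hval]
        exact hv
      have h1 : v = A x (e'.symm v) := by
        rw [← he']
        simp
      rw [h1, hAapp, h0, zero_smul, add_zero]
      exact Submodule.sum_mem _ fun i _ => Submodule.smul_mem _ _ ⟨X i, hXH i, rfl⟩
    have hrk := (θ : State (m + 1) →ₗ[ℝ] ℝ).finrank_range_add_finrank_ker
    have hrange : finrank ℝ (LinearMap.range (θ : State (m + 1) →ₗ[ℝ] ℝ)) ≤ 1 := by
      simpa using Submodule.finrank_le (LinearMap.range (θ : State (m + 1) →ₗ[ℝ] ℝ))
    have heq : LinearMap.ker (θ : State (m + 1) →ₗ[ℝ] ℝ) = H.atPoint x := by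
      refine Submodule.eq_of_le_of_finrank_le hle ?_
      have := hr x hx.1
      rw [finrank_fin_fun] at hrk
      omega
    intro v
    rw [← heq]
    rfl

/-- **Pfaff's theorem** in class three: a one-form `θ` such that `dθ` has rank exactly two on
`ker θ` is near `p` a combination of two differentials `da` and `ds`. The rank condition is
expressed by a pair `Y₁`, `Y₂` of vector fields in `ker θ` that span it modulo the kernel of
`dθ`.

The function `s` is a first integral of the characteristic distribution
`ker θ ∩ ker (Y₁ ⌟ dθ) ∩ ker (Y₂ ⌟ dθ)`, and `a` is one of the distribution `ker θ ∩ ker ds`. -/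
theorem exists_pfaff_coordinates {W : Set (State n)} (hW : IsOpen W) {θ : OneForm n}
    (hθ : ContDiffOn ℝ ∞ θ W) {Y₁ Y₂ : VecField n} (hY₁ : ContDiffOn ℝ ∞ Y₁ W)
    (hY₂ : ContDiffOn ℝ ∞ Y₂ W) (hθY₁ : ∀ x ∈ W, θ x (Y₁ x) = 0) (hθY₂ : ∀ x ∈ W, θ x (Y₂ x) = 0)
    (hY : ∀ x ∈ W, contractExtDeriv θ x (Y₁ x) (Y₂ x) ≠ 0)
    (hchar : ∀ x ∈ W, ∀ X Z, θ x X = 0 → θ x Z = 0 → contractExtDeriv θ x X (Y₁ x) = 0 →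
      contractExtDeriv θ x X (Y₂ x) = 0 → contractExtDeriv θ x X Z = 0)
    {p : State n} (hp : p ∈ W) (hθp : θ p ≠ 0) :
    ∃ (W' : Set (State n)) (s a : State n → ℝ), IsOpen W' ∧ p ∈ W' ∧ W' ⊆ W ∧
      ContDiffOn ℝ ∞ s W' ∧ ContDiffOn ℝ ∞ a W' ∧ ∀ x ∈ W',
        (∃ u v, fderiv ℝ s x u * fderiv ℝ a x v - fderiv ℝ s x v * fderiv ℝ a x u ≠ 0) ∧
        ∀ X Y, θ x X = 0 → θ x Y = 0 →
          fderiv ℝ a x X * fderiv ℝ s x Y - fderiv ℝ a x Y * fderiv ℝ s x X = 0 := by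
  obtain ⟨e, he⟩ : ∃ e, θ p e = 1 := by
    obtain ⟨v, hv⟩ : ∃ v, θ p v ≠ 0 := by
      by_contra! h
      exact hθp (ContinuousLinearMap.ext h)
    exact ⟨(θ p v)⁻¹ • v, by simp [hv]⟩
  have hsw := contractExtDeriv_swap θ
  have hself : ∀ x X, contractExtDeriv θ x X X = 0 := fun x X => by linarith [hsw x X X]
  -- The characteristic distribution and its three defining forms.
  let Θ : State n → State n →L[ℝ] Fin 3 → ℝ := fun x =>
    ContinuousLinearMap.pi ![θ x, contractExtDeriv θ x (Y₁ x), contractExtDeriv θ x (Y₂ x)]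
  have hΘapp : ∀ x v, Θ x v =
      ![θ x v, contractExtDeriv θ x (Y₁ x) v, contractExtDeriv θ x (Y₂ x) v] := by
    intro x v
    ext i
    fin_cases i <;> rfl
  have hΘ0 : ∀ x v, Θ x v = 0 ↔ θ x v = 0 ∧ contractExtDeriv θ x v (Y₁ x) = 0 ∧
      contractExtDeriv θ x v (Y₂ x) = 0 := by
    intro x v
    rw [hΘapp, hsw x v (Y₁ x), hsw x v (Y₂ x)]
    simp
  have hΘ : ContDiffOn ℝ ∞ Θ W := by
    rw [contDiffOn_clm_apply]
    intro v
    simp only [hΘapp]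
    rw [contDiffOn_pi]
    intro i
    fin_cases i
    · exact hθ.clm_apply contDiffOn_const
    · exact (contDiffOn_contractExtDeriv hW hθ hY₁).clm_apply contDiffOn_const
    · exact (contDiffOn_contractExtDeriv hW hθ hY₂).clm_apply contDiffOn_const
  have hΘs : Function.Surjective (Θ p) := by
    intro y
    have hd := hY p hp
    set d := contractExtDeriv θ p (Y₁ p) (Y₂ p) with hd'
    refine ⟨y 0 • e + ((y 1 - y 0 * contractExtDeriv θ p (Y₁ p) e) / d) • Y₂ p
      - ((y 2 - y 0 * contractExtDeriv θ p (Y₂ p) e) / d) • Y₁ p, ?_⟩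
    rw [hΘapp]
    simp only [map_add, map_sub, map_smul, smul_eq_mul, he, hθY₁ p hp, hθY₂ p hp, hself,
      hsw p (Y₂ p) (Y₁ p), ← hd']
    ext i
    fin_cases i
    · simp
    · simp [hd]
    · simp [hd]
  have hbr : ∀ {V : Set (State n)}, IsOpen V → V ⊆ W → ∀ {X Y : VecField n},
      ContDiffOn ℝ ∞ X V → ContDiffOn ℝ ∞ Y V → (∀ x ∈ V, θ x (X x) = 0) →
      (∀ x ∈ V, θ x (Y x) = 0) → ∀ x ∈ V,
        θ x (lieBracket ℝ X Y x) = -contractExtDeriv θ x (X x) (Y x) :=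
    fun hV hVW _ _ hX hY h1 h2 x hx => apply_lieBracket_eq_neg_contractExtDeriv
      (hθ.differentiableAt_of_isOpen hW (hVW hx)) (hX.differentiableAt_of_isOpen hV hx)
      (hY.differentiableAt_of_isOpen hV hx) (eventually_of_mem (hV.mem_nhds hx) h1)
      (eventually_of_mem (hV.mem_nhds hx) h2)
  obtain ⟨W₁, h, hW₁, hpW₁, hW₁W, hh, hhd⟩ := exists_first_integrals hW hΘ hp hΘs (by
    intro X Y V hV hVW hX hY hΘX hΘY
    have hθX : ∀ x ∈ V, θ x (X x) = 0 := fun x hx => ((hΘ0 x _).1 (hΘX x hx)).1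
    have hθY : ∀ x ∈ V, θ x (Y x) = 0 := fun x hx => ((hΘ0 x _).1 (hΘY x hx)).1
    have hcX : ∀ x ∈ V, ∀ Z, θ x Z = 0 → contractExtDeriv θ x (X x) Z = 0 := fun x hx Z hZ =>
      hchar x (hVW hx) _ Z (hθX x hx) hZ ((hΘ0 x _).1 (hΘX x hx)).2.1
        ((hΘ0 x _).1 (hΘX x hx)).2.2
    have hcY : ∀ x ∈ V, ∀ Z, θ x Z = 0 → contractExtDeriv θ x (Y x) Z = 0 := fun x hx Z hZ =>
      hchar x (hVW hx) _ Z (hθY x hx) hZ ((hΘ0 x _).1 (hΘY x hx)).2.1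
        ((hΘ0 x _).1 (hΘY x hx)).2.2
    have hXY := hX.lieBracket_of_isOpen hV hY
    have hθXY : ∀ x ∈ V, θ x (lieBracket ℝ X Y x) = 0 := fun x hx => by
      rw [hbr hV hVW hX hY hθX hθY x hx, hcX x hx _ (hθY x hx), neg_zero]
    -- The Jacobi identity for `Z = Y₁, Y₂` and the characteristic fields `X`, `Y`.
    have hjac : ∀ Z : VecField n, ContDiffOn ℝ ∞ Z W → (∀ x ∈ W, θ x (Z x) = 0) → ∀ x ∈ V,
        contractExtDeriv θ x (lieBracket ℝ X Y x) (Z x) = 0 := by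
      intro Z hZ hθZ x hx
      have hZV := hZ.mono hVW
      have hθZV : ∀ x ∈ V, θ x (Z x) = 0 := fun x hx => hθZ x (hVW hx)
      have hZX := hZV.lieBracket_of_isOpen hV hX
      have hZY := hZV.lieBracket_of_isOpen hV hY
      have hθZX : ∀ x ∈ V, θ x (lieBracket ℝ Z X x) = 0 := fun x hx => by
        rw [hbr hV hVW hZV hX hθZV hθX x hx, hsw, hcX x hx _ (hθZV x hx), neg_zero, neg_zero]
      have hθZY : ∀ x ∈ V, θ x (lieBracket ℝ Z Y x) = 0 := fun x hx => by
        rw [hbr hV hVW hZV hY hθZV hθY x hx, hsw, hcY x hx _ (hθZV x hx), neg_zero, neg_zero]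
      have h1 := hbr hV hVW hZV hXY hθZV hθXY x hx
      rw [leibniz_identity_lieBracket minSmoothness_two_le_infty
        (hZV.contDiffAt (hV.mem_nhds hx)) (hX.contDiffAt (hV.mem_nhds hx))
        (hY.contDiffAt (hV.mem_nhds hx)), map_add, hbr hV hVW hZX hY hθZX hθY x hx,
        hbr hV hVW hX hZY hθX hθZY x hx, hcX x hx _ (hθZY x hx), hsw x _ (Y x),
        hcY x hx _ (hθZX x hx), hsw x (Z x)] at h1
      linarith
    intro x hx
    exact (hΘ0 x _).2 ⟨hθXY x hx, hjac Y₁ hY₁ hθY₁ x hx, hjac Y₂ hY₂ hθY₂ x hx⟩)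
  -- A component `s` of `h` whose differential is not proportional to `θ` at `p`.
  obtain ⟨v₀, i, hv₀, hiv₀⟩ := exists_apply_ne_zero_of_surjective
    (L := (fderiv ℝ h p : State n →ₗ[ℝ] Fin 3 → ℝ)) (hhd p hpW₁).1 (θ p : State n →ₗ[ℝ] ℝ)
  let s : State n → ℝ := fun x => h x i
  have hs : ContDiffOn ℝ ∞ s W₁ := contDiffOn_pi.1 hh i
  have hds : ∀ x ∈ W₁, ∀ v, fderiv ℝ s x v = fderiv ℝ h x v i := by
    intro x hx v
    have h1 := hasFDerivAt_pi'.1 (hh.differentiableAt_of_isOpen hW₁ hx).hasFDerivAt i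
    rw [h1.fderiv]
    rfl
  have hsΘ : ∀ x ∈ W₁, ∀ v, θ x v = 0 → contractExtDeriv θ x v (Y₁ x) = 0 →
      contractExtDeriv θ x v (Y₂ x) = 0 → fderiv ℝ s x v = 0 := by
    intro x hx v h1 h2 h3
    rw [hds x hx, (hhd x hx).2 v ((hΘ0 x v).2 ⟨h1, h2, h3⟩)]
    rfl
  -- On `ker θ`, modulo the characteristic distribution, `X` is a combination of `Y₁` and `Y₂`.
  have hdec : ∀ x ∈ W₁, ∀ X, θ x X = 0 →
      (∀ Z, θ x Z = 0 → contractExtDeriv θ x (contractExtDeriv θ x (Y₁ x) X • Y₂ x -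
        contractExtDeriv θ x (Y₂ x) X • Y₁ x - contractExtDeriv θ x (Y₁ x) (Y₂ x) • X) Z = 0) ∧
      contractExtDeriv θ x (Y₁ x) X * fderiv ℝ s x (Y₂ x) -
        contractExtDeriv θ x (Y₂ x) X * fderiv ℝ s x (Y₁ x) =
          contractExtDeriv θ x (Y₁ x) (Y₂ x) * fderiv ℝ s x X := by
    intro x hx X hX
    have hxW := hW₁W hx
    set T := contractExtDeriv θ x (Y₁ x) X • Y₂ x - contractExtDeriv θ x (Y₂ x) X • Y₁ x -
        contractExtDeriv θ x (Y₁ x) (Y₂ x) • X with hT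
    have hθT : θ x T = 0 := by simp [hT, hX, hθY₁ x hxW, hθY₂ x hxW]
    have hT1 : contractExtDeriv θ x T (Y₁ x) = 0 := by
      rw [hsw, hT]
      simp only [map_sub, map_smul, smul_eq_mul, hself]
      ring
    have hT2 : contractExtDeriv θ x T (Y₂ x) = 0 := by
      rw [hsw, hT]
      simp only [map_sub, map_smul, smul_eq_mul, hself, hsw x (Y₂ x) (Y₁ x)]
      ring
    refine ⟨fun Z hZ => hchar x hxW T Z hθT hZ hT1 hT2, ?_⟩
    have h1 := hsΘ x hx T hθT hT1 hT2
    simp only [hT, map_sub, map_smul, smul_eq_mul] at h1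
    linarith
  obtain ⟨W₂, hW₂, hpW₂, hW₂₁, hsY⟩ : ∃ W₂, IsOpen W₂ ∧ p ∈ W₂ ∧ W₂ ⊆ W₁ ∧
      ∀ x ∈ W₂, fderiv ℝ s x (Y₁ x) ≠ 0 ∨ fderiv ℝ s x (Y₂ x) ≠ 0 := by
    have hc : ∀ {Y : VecField n}, ContDiffOn ℝ ∞ Y W →
        ContinuousOn (fun x => fderiv ℝ s x (Y x)) W₁ := fun hY =>
      ((hs.fderiv_infty_of_isOpen hW₁).clm_apply (hY.mono hW₁W)).continuousOn
    refine ⟨(W₁ ∩ (fun x => fderiv ℝ s x (Y₁ x)) ⁻¹' {0}ᶜ) ∪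
      (W₁ ∩ (fun x => fderiv ℝ s x (Y₂ x)) ⁻¹' {0}ᶜ),
      ((hc hY₁).isOpen_inter_preimage hW₁ isOpen_compl_singleton).union
        ((hc hY₂).isOpen_inter_preimage hW₁ isOpen_compl_singleton), ?_,
      union_subset inter_subset_left inter_subset_left,
      fun x hx => hx.imp (fun h => h.2) (fun h => h.2)⟩
    by_contra hcon
    simp only [mem_union, mem_inter_iff, hpW₁, true_and, mem_preimage, mem_compl_iff,
      mem_singleton_iff, not_or, not_not] at hcon
    have h1 := (hdec p hpW₁ v₀ hv₀).2
    rw [hcon.1, hcon.2, mul_zero, mul_zero, sub_zero] at h1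
    rcases mul_eq_zero.1 h1.symm with h2 | h2
    · exact hY p hp h2
    · rw [hds p hpW₁] at h2
      exact hiv₀ h2
  have hW₂W : W₂ ⊆ W := hW₂₁.trans hW₁W
  have hs2 := hs.mono hW₂₁
  -- Hence `dθ` vanishes on `ker θ ∩ ker ds`, and this distribution is involutive.
  have hiso : ∀ x ∈ W₂, ∀ X Y, θ x X = 0 → θ x Y = 0 → fderiv ℝ s x X = 0 →
      fderiv ℝ s x Y = 0 → contractExtDeriv θ x X Y = 0 := by
    intro x hx X Y hX hY' hsX hsY'
    obtain ⟨hTX, h1⟩ := hdec x (hW₂₁ hx) X hX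
    obtain ⟨-, h2⟩ := hdec x (hW₂₁ hx) Y hY'
    rw [hsX, mul_zero] at h1
    rw [hsY', mul_zero] at h2
    have h3 := hTX Y hY'
    simp only [map_sub, map_smul, smul_eq_mul, _root_.sub_apply,
      _root_.smul_apply] at h3
    have h4 : contractExtDeriv θ x (Y₁ x) X * contractExtDeriv θ x (Y₂ x) Y -
        contractExtDeriv θ x (Y₂ x) X * contractExtDeriv θ x (Y₁ x) Y = 0 := by
      rcases hsY x hx with h | h
      · refine (mul_eq_zero.1 ?_).resolve_left h
        linear_combination contractExtDeriv θ x (Y₁ x) Y * h1 - contractExtDeriv θ x (Y₁ x) X * h2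
      · refine (mul_eq_zero.1 ?_).resolve_left h
        linear_combination contractExtDeriv θ x (Y₂ x) Y * h1 - contractExtDeriv θ x (Y₂ x) X * h2
    refine (mul_eq_zero.1 ?_).resolve_left (hY x (hW₂W hx))
    linarith
  let Θ₂ : State n → State n →L[ℝ] Fin 2 → ℝ := fun x =>
    ContinuousLinearMap.pi ![θ x, fderiv ℝ s x]
  have hΘ₂app : ∀ x v, Θ₂ x v = ![θ x v, fderiv ℝ s x v] := by
    intro x v
    ext i
    fin_cases i <;> rfl
  have hΘ₂0 : ∀ x v, Θ₂ x v = 0 ↔ θ x v = 0 ∧ fderiv ℝ s x v = 0 := by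
    intro x v
    rw [hΘ₂app]
    simp
  have hΘ₂ : ContDiffOn ℝ ∞ Θ₂ W₂ := by
    rw [contDiffOn_clm_apply]
    intro v
    simp only [hΘ₂app]
    rw [contDiffOn_pi]
    intro i
    fin_cases i
    · exact (hθ.mono hW₂W).clm_apply contDiffOn_const
    · exact (hs2.fderiv_infty_of_isOpen hW₂).clm_apply contDiffOn_const
  have hsv₀ : fderiv ℝ s p v₀ ≠ 0 := by
    rw [hds p hpW₁]
    exact hiv₀
  have hθv₀ : θ p v₀ = 0 := hv₀
  have hΘ₂s : Function.Surjective (Θ₂ p) := by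
    intro y
    refine ⟨y 0 • e + ((y 1 - y 0 * fderiv ℝ s p e) / fderiv ℝ s p v₀) • v₀, ?_⟩
    rw [hΘ₂app]
    ext i
    fin_cases i
    · simp [he, hθv₀]
    · simp [hsv₀]
  obtain ⟨W₃, k, hW₃, hpW₃, hW₃₂, hk, hkd⟩ := exists_first_integrals hW₂ hΘ₂ hpW₂ hΘ₂s (by
    intro X Y V hV hVW hX hY hΘX hΘY x hx
    have hX0 := fun x hx => (hΘ₂0 x _).1 (hΘX x hx)
    have hY0 := fun x hx => (hΘ₂0 x _).1 (hΘY x hx)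
    refine (hΘ₂0 x _).2 ⟨?_, fderiv_apply_lieBracket_eq_zero hV (hs2.mono hVW) hX hY
      (fun x hx => (hX0 x hx).2) (fun x hx => (hY0 x hx).2) hx⟩
    rw [hbr hV (hVW.trans hW₂W) hX hY (fun x hx => (hX0 x hx).1) (fun x hx => (hY0 x hx).1) x hx,
      hiso x (hVW hx) _ _ (hX0 x hx).1 (hY0 x hx).1 (hX0 x hx).2 (hY0 x hx).2, neg_zero])
  obtain ⟨v₁, j, hv₁, hjv₁⟩ := exists_apply_ne_zero_of_surjective (k := 0)
    (L := (fderiv ℝ k p : State n →ₗ[ℝ] Fin 2 → ℝ)) (hkd p hpW₃).1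
    (fderiv ℝ s p : State n →ₗ[ℝ] ℝ)
  let a : State n → ℝ := fun x => k x j
  have ha : ContDiffOn ℝ ∞ a W₃ := contDiffOn_pi.1 hk j
  have hda : ∀ x ∈ W₃, ∀ v, fderiv ℝ a x v = fderiv ℝ k x v j := by
    intro x hx v
    have h1 := hasFDerivAt_pi'.1 (hk.differentiableAt_of_isOpen hW₃ hx).hasFDerivAt j
    rw [h1.fderiv]
    rfl
  have hs3 := hs2.mono hW₃₂
  have hcont : ContinuousOn (fun x => fderiv ℝ s x v₀ * fderiv ℝ a x v₁ -
      fderiv ℝ s x v₁ * fderiv ℝ a x v₀) W₃ := by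
    have h1 := hs3.fderiv_infty_of_isOpen hW₃
    have h2 := ha.fderiv_infty_of_isOpen hW₃
    exact (((h1.clm_apply contDiffOn_const).mul (h2.clm_apply contDiffOn_const)).sub
      ((h1.clm_apply contDiffOn_const).mul (h2.clm_apply contDiffOn_const))).continuousOn
  refine ⟨_, s, a, hcont.isOpen_inter_preimage hW₃ (isOpen_compl_singleton (x := 0)), ⟨hpW₃, ?_⟩,
    inter_subset_left.trans (hW₃₂.trans hW₂W), hs3.mono inter_subset_left,
    ha.mono inter_subset_left, fun x hx => ⟨⟨v₀, v₁, hx.2⟩, fun X Y hX hY => ?_⟩⟩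
  · have h1 : fderiv ℝ s p v₁ = 0 := hv₁
    have h2 : fderiv ℝ a p v₁ ≠ 0 := by
      rw [hda p hpW₃]
      exact hjv₁
    simp [h1, h2, hsv₀]
  · have h1 := (hkd x hx.1).2 (fderiv ℝ s x Y • X - fderiv ℝ s x X • Y) ((hΘ₂0 x _).2
      ⟨by simp [hX, hY], by simp only [map_sub, map_smul, smul_eq_mul]; ring⟩)
    have h2 := congrFun h1 j
    rw [← hda x hx.1] at h2
    simp only [map_sub, map_smul, smul_eq_mul, Pi.zero_apply] at h2
    linarith

end Pfaff

/-! ### Chained coordinates for the derived flag -/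

section Chained

open Set Filter Topology VectorField Module

variable {n : ℕ}

theorem finrank_le_finrank_inf_ker_add_one {E : Type*} [AddCommGroup E] [Module ℝ E]
    [FiniteDimensional ℝ E] (S : Submodule ℝ E) (l : E →ₗ[ℝ] ℝ) :
    finrank ℝ S ≤ finrank ℝ ↥(S ⊓ LinearMap.ker l) + 1 := by
  have h1 := (l.domRestrict S).finrank_range_add_finrank_ker
  have h2 : finrank ℝ (LinearMap.range (l.domRestrict S)) ≤ 1 := by
    simpa using Submodule.finrank_le (LinearMap.range (l.domRestrict S))
  have h3 : (LinearMap.ker (l.domRestrict S)).map S.subtype = S ⊓ LinearMap.ker l := by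
    ext v
    simp [and_comm]
  have h4 := Submodule.finrank_map_subtype_eq S (LinearMap.ker (l.domRestrict S))
  rw [h3] at h4
  omega

/-- The common kernel at `x` of the differentials of `w₀, …, w_{m-1}`. -/
def commonKer (w : ℕ → State n → ℝ) (m : ℕ) (x : State n) : Submodule ℝ (State n) where
  carrier := {v | ∀ i < m, fderiv ℝ (w i) x v = 0}
  add_mem' := fun h1 h2 i hi => by simp [h1 i hi, h2 i hi]
  zero_mem' := fun _ _ => map_zero _
  smul_mem' := fun c _ h i hi => by simp [h i hi]

theorem mem_commonKer {w : ℕ → State n → ℝ} {m : ℕ} {x v : State n} :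
    v ∈ commonKer w m x ↔ ∀ i < m, fderiv ℝ (w i) x v = 0 := Iff.rfl

theorem commonKer_succ (w : ℕ → State n → ℝ) (m : ℕ) (x : State n) :
    commonKer w (m + 1) x =
      commonKer w m x ⊓ LinearMap.ker (fderiv ℝ (w m) x : State n →ₗ[ℝ] ℝ) := by
  ext v
  simp only [mem_commonKer, Submodule.mem_inf, LinearMap.mem_ker, Nat.lt_succ_iff_lt_or_eq]
  exact ⟨fun h => ⟨fun i hi => h i (Or.inl hi), h m (Or.inr rfl)⟩,
    fun h i hi => hi.elim (h.1 i) fun hi => hi ▸ h.2⟩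

/-- Functions `w₀ = s` and `w₁, …, w_{j+1}` on `W`, with independent differentials, such that the
forms `dw_{i+1} - w_{i+2} ds`, `i < j`, annihilate `G_{n-3-i}`, and `dw_{j+1} ∧ ds` vanishes on
`G_{n-3-j}` (so that a further form of this kind can be found). Independence is recorded as a bound
on the dimension of the common kernel. -/
structure IsPartialChain (U : Set (State n)) (g₁ g₂ : VecField n) (W : Set (State n))
    (w : ℕ → State n → ℝ) (j : ℕ) : Prop where
  smooth : ∀ i ≤ j + 1, ContDiffOn ℝ ∞ (w i) W
  rank : ∀ x ∈ W, finrank ℝ (commonKer w (j + 2) x) + (j + 2) ≤ n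
  annihilates : ∀ i < j, ∀ k, i + k + 3 = n → ∀ x ∈ W, ∀ v ∈ (controlFlag U g₁ g₂ k).atPoint x,
    fderiv ℝ (w (i + 1)) x v = w (i + 2) x * fderiv ℝ (w 0) x v
  wedge : ∀ k, j + k + 3 = n → ∀ x ∈ W, ∀ X ∈ (controlFlag U g₁ g₂ k).atPoint x,
    ∀ Y ∈ (controlFlag U g₁ g₂ k).atPoint x,
      fderiv ℝ (w (j + 1)) x X * fderiv ℝ (w 0) x Y -
        fderiv ℝ (w (j + 1)) x Y * fderiv ℝ (w 0) x X = 0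

/-- The value of `da - b dc` on a bracket of vector fields in its kernel. -/
theorem sub_smul_apply_lieBracket {W : Set (State n)} (hW : IsOpen W) {a b c : State n → ℝ}
    (ha : ContDiffOn ℝ ∞ a W) (hb : ContDiffOn ℝ ∞ b W) (hc : ContDiffOn ℝ ∞ c W)
    {X Y : VecField n} (hX : ContDiffOn ℝ ∞ X W) (hY : ContDiffOn ℝ ∞ Y W)
    (hX0 : ∀ x ∈ W, fderiv ℝ a x (X x) = b x * fderiv ℝ c x (X x))
    (hY0 : ∀ x ∈ W, fderiv ℝ a x (Y x) = b x * fderiv ℝ c x (Y x)) {x : State n} (hx : x ∈ W) :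
    fderiv ℝ a x (lieBracket ℝ X Y x) - b x * fderiv ℝ c x (lieBracket ℝ X Y x) =
      fderiv ℝ b x (X x) * fderiv ℝ c x (Y x) - fderiv ℝ b x (Y x) * fderiv ℝ c x (X x) := by
  have hθ : ContDiffOn ℝ ∞ (fun x => fderiv ℝ a x - b x • fderiv ℝ c x) W :=
    (ha.fderiv_infty_of_isOpen hW).sub (hb.smul (hc.fderiv_infty_of_isOpen hW))
  have h := apply_lieBracket_eq_neg_contractExtDeriv (hθ.differentiableAt_of_isOpen hW hx)
    (hX.differentiableAt_of_isOpen hW hx) (hY.differentiableAt_of_isOpen hW hx)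
    (eventually_of_mem (hW.mem_nhds hx) fun y hy => by simp [hX0 y hy])
    (eventually_of_mem (hW.mem_nhds hx) fun y hy => by simp [hY0 y hy])
  rw [contractExtDeriv_sub_smul hW ha hb hc hx, neg_neg] at h
  simpa using h

/-- The derived flag cannot stagnate at a point where its dimension grows. -/
theorem not_brackets_mem {U : Set (State n)} {g₁ g₂ : VecField n} {k : ℕ} {x : State n}
    (h0 : finrank ℝ ((controlFlag U g₁ g₂ k).atPoint x) = 2 + k)
    (h1 : finrank ℝ ((controlFlag U g₁ g₂ (k + 1)).atPoint x) = 2 + (k + 1)) :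
    ¬ ∀ X ∈ controlFlag U g₁ g₂ k, ∀ Y ∈ controlFlag U g₁ g₂ k,
      lieBracket ℝ X Y x ∈ (controlFlag U g₁ g₂ k).atPoint x := fun hb => by
  have := Submodule.finrank_mono (controlFlag_succ_atPoint_le
    (S := (controlFlag U g₁ g₂ k).atPoint x) (fun X hX => ⟨X, hX, rfl⟩) hb)
  omega

variable {U : Set (State n)} {g₁ g₂ : VecField n}

/-- The top of the derived flag: independent functions `s`, `a` with `da ∧ ds = 0` on the corank
one distribution `G_{n-3}`. Its annihilating form `θ` has class three because `dθ` does not vanish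
on `G_{n-3}`, whereas it vanishes on `G_{n-4}` (for `n = 3`, on a line). -/
theorem exists_partialChain_zero (hU : IsOpen U) (hg₁ : ContDiffOn ℝ ∞ g₁ U)
    (hg₂ : ContDiffOn ℝ ∞ g₂ U) {W : Set (State n)} (hW : IsOpen W) (hWU : W ⊆ U)
    (hdim : ∀ k, k + 2 ≤ n → ∀ q ∈ W, finrank ℝ ((controlFlag U g₁ g₂ k).atPoint q) = 2 + k)
    (hn : 3 ≤ n) {p : State n} (hp : p ∈ W) :
    ∃ (W' : Set (State n)) (w : ℕ → State n → ℝ), IsOpen W' ∧ W'.Nonempty ∧ W' ⊆ W ∧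
      IsPartialChain U g₁ g₂ W' w 0 := by
  obtain ⟨m, rfl⟩ : ∃ m, n = m + 3 := ⟨n - 3, by omega⟩
  have hsm : ∀ k, ∀ X ∈ controlFlag U g₁ g₂ k, ContDiffOn ℝ ∞ X U :=
    fun k X hX => contDiffOn_of_mem_controlFlag hU hg₁ hg₂ k hX
  obtain ⟨W₁, θ, hW₁, hpW₁, hW₁W, hθ, hker⟩ := exists_annihilating_form hW
    (controlFlag U g₁ g₂ m) (fun X hX => (hsm m X hX).mono hWU)
    (fun x hx => by rw [hdim m (by omega) x hx]; omega) hp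
  have hW₁U := hW₁W.trans hWU
  have hθ0 : ∀ X ∈ controlFlag U g₁ g₂ m, ∀ x ∈ W₁, θ x (X x) = 0 :=
    fun X hX x hx => (hker x hx _).2 ⟨X, hX, rfl⟩
  have hbr : ∀ X ∈ controlFlag U g₁ g₂ m, ∀ Y ∈ controlFlag U g₁ g₂ m, ∀ x ∈ W₁,
      θ x (lieBracket ℝ X Y x) = -contractExtDeriv θ x (X x) (Y x) := fun X hX Y hY x hx =>
    apply_lieBracket_eq_neg_contractExtDeriv (hθ.differentiableAt_of_isOpen hW₁ hx)
      (((hsm m X hX).mono hW₁U).differentiableAt_of_isOpen hW₁ hx)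
      (((hsm m Y hY).mono hW₁U).differentiableAt_of_isOpen hW₁ hx)
      (eventually_of_mem (hW₁.mem_nhds hx) (hθ0 X hX))
      (eventually_of_mem (hW₁.mem_nhds hx) (hθ0 Y hY))
  obtain ⟨Y₁, hY₁, Y₂, hY₂, hY⟩ : ∃ Y₁ ∈ controlFlag U g₁ g₂ m, ∃ Y₂ ∈ controlFlag U g₁ g₂ m,
      contractExtDeriv θ p (Y₁ p) (Y₂ p) ≠ 0 := by
    by_contra! hcon
    refine not_brackets_mem (hdim m (by omega) p hp) (hdim (m + 1) (by omega) p hp)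
      fun X hX Y hY => (hker p hpW₁ _).1 ?_
    rw [hbr X hX Y hY p hpW₁, hcon X hX Y hY, neg_zero]
  have hY₁s := (hsm m Y₁ hY₁).mono hW₁U
  have hY₂s := (hsm m Y₂ hY₂).mono hW₁U
  have hcont : ContinuousOn (fun x => contractExtDeriv θ x (Y₁ x) (Y₂ x)) W₁ :=
    ((contDiffOn_contractExtDeriv hW₁ hθ hY₁s).clm_apply hY₂s).continuousOn
  let W₂ := W₁ ∩ (fun x => contractExtDeriv θ x (Y₁ x) (Y₂ x)) ⁻¹' {0}ᶜ
  have hW₂ : IsOpen W₂ := hcont.isOpen_inter_preimage hW₁ isOpen_compl_singleton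
  have hW₂₁ : W₂ ⊆ W₁ := inter_subset_left
  have hθp : θ p ≠ 0 := by
    intro h0
    have h1 : (controlFlag U g₁ g₂ m).atPoint p = ⊤ :=
      Submodule.eq_top_iff'.2 fun v => (hker p hpW₁ v).1 (by rw [h0]; rfl)
    have h2 := hdim m (by omega) p hp
    rw [h1, finrank_top, finrank_fin_fun] at h2
    omega
  obtain ⟨W₃, s, a, hW₃, hpW₃, hW₃₂, hs, ha, h⟩ := exists_pfaff_coordinates hW₂ (hθ.mono hW₂₁)
    (hY₁s.mono hW₂₁) (hY₂s.mono hW₂₁) (fun x hx => hθ0 _ hY₁ x hx.1) (fun x hx => hθ0 _ hY₂ x hx.1)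
    (fun x hx => hx.2) (by
      intro x hx X Z hX hZ hX1 hX2
      -- A subspace of codimension one in `G_{n-3}(x)` on which `dθ` vanishes.
      obtain ⟨K, hKH, hrK, hK⟩ : ∃ K ≤ (controlFlag U g₁ g₂ m).atPoint x, 1 + m ≤ finrank ℝ K ∧
          ∀ u ∈ K, ∀ v ∈ K, contractExtDeriv θ x u v = 0 := by
        rcases m with - | m
        · have h2 := hdim 0 (by omega) x (hW₁W hx.1)
          obtain ⟨v, hv, hv0⟩ : ∃ v ∈ (controlFlag U g₁ g₂ 0).atPoint x, v ≠ 0 := by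
            refine Submodule.exists_mem_ne_zero_of_ne_bot fun hbot => ?_
            rw [hbot, finrank_bot] at h2
            omega
          refine ⟨Submodule.span ℝ {v}, by simpa [Submodule.span_le] using hv,
            (finrank_span_singleton hv0).ge, fun u hu u' hu' => ?_⟩
          obtain ⟨c, rfl⟩ := Submodule.mem_span_singleton.1 hu
          obtain ⟨c', rfl⟩ := Submodule.mem_span_singleton.1 hu'
          have h3 : contractExtDeriv θ x v v = 0 := by linarith [contractExtDeriv_swap θ x v v]
          simp [h3]
        · have hmono : controlFlag U g₁ g₂ m ≤ controlFlag U g₁ g₂ (m + 1) :=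
            controlFlag_mono (Nat.le_succ m)
          refine ⟨(controlFlag U g₁ g₂ m).atPoint x, ?_, ?_, ?_⟩
          · rintro _ ⟨X, hX, rfl⟩
            exact ⟨X, hmono hX, rfl⟩
          · rw [hdim m (by omega) x (hW₁W hx.1)]
            omega
          · rintro _ ⟨A, hA, rfl⟩ _ ⟨B, hB, rfl⟩
            have h4 := hbr A (hmono hA) B (hmono hB) x hx.1
            rw [hθ0 _ (lieBracket_mem_controlFlag hA hB) x hx.1] at h4
            linarith
      let B : State (m + 3) →ₗ[ℝ] State (m + 3) →ₗ[ℝ] ℝ :=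
        LinearMap.mk₂ ℝ (fun u v => contractExtDeriv θ x u v) (by simp) (by simp) (by simp)
          (by simp)
      exact apply_eq_zero_of_isotropic B (fun u v => contractExtDeriv_swap θ x u v) hKH
        (by rw [hdim m (by omega) x (hW₁W hx.1)]; omega) hK
        (⟨Y₁, hY₁, rfl⟩ : Y₁ x ∈ (controlFlag U g₁ g₂ m).atPoint x)
        (⟨Y₂, hY₂, rfl⟩ : Y₂ x ∈ (controlFlag U g₁ g₂ m).atPoint x)
        ((hker x hx.1 X).1 hX) ((hker x hx.1 Z).1 hZ) hx.2 hX1 hX2) ⟨hpW₁, hY⟩ hθp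
  refine ⟨W₃, fun i => if i = 0 then s else a, hW₃, ⟨p, hpW₃⟩,
    hW₃₂.trans (hW₂₁.trans hW₁W), ?_, ?_, fun i hi => absurd hi (by omega), ?_⟩
  · intro i _
    by_cases hi : i = 0
    · simpa [hi] using hs
    · simpa [hi] using ha
  · intro x hx
    obtain ⟨⟨u, v, huv⟩, -⟩ := h x hx
    have h5 := finrank_inf_ker_add_two_le (fderiv ℝ s x : State (m + 3) →ₗ[ℝ] ℝ)
      (fderiv ℝ a x : State (m + 3) →ₗ[ℝ] ℝ) u v huv
    rw [finrank_fin_fun] at h5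
    have h6 : commonKer (fun i => if i = 0 then s else a) 2 x =
        LinearMap.ker (fderiv ℝ s x : State (m + 3) →ₗ[ℝ] ℝ) ⊓
          LinearMap.ker (fderiv ℝ a x : State (m + 3) →ₗ[ℝ] ℝ) := by
      rw [commonKer_succ, commonKer_succ]
      ext v
      simp [mem_commonKer]
    change finrank ℝ (commonKer (fun i => if i = 0 then s else a) 2 x) + 2 ≤ m + 3
    rw [h6]
    exact h5
  · intro k hk x hx X hX Y hY
    obtain rfl : k = m := by omega
    have hx1 := hW₂₁ (hW₃₂ hx)
    simpa using (h x hx).2 X Y ((hker x hx1 X).2 hX) ((hker x hx1 Y).2 hY)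

/-- One more function is added to a partial chain: `w_{j+2}` is the ratio of `dw_{j+1}` and `ds` on
`H = G_{n-3-j}`. If `ds` vanished on `H` over an open set, or if `dw_{j+2}` depended on the previous
differentials at some point, `H` would contain its own brackets there, contrary to the growth of the
derived flag. -/
theorem IsPartialChain.exists_succ (hU : IsOpen U) (hg₁ : ContDiffOn ℝ ∞ g₁ U)
    (hg₂ : ContDiffOn ℝ ∞ g₂ U) {W : Set (State n)} (hW : IsOpen W) (hWU : W ⊆ U)
    (hdim : ∀ k, k + 2 ≤ n → ∀ q ∈ W, finrank ℝ ((controlFlag U g₁ g₂ k).atPoint q) = 2 + k)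
    (hne : W.Nonempty) {w : ℕ → State n → ℝ} {j : ℕ} (hj : j + 3 ≤ n)
    (h : IsPartialChain U g₁ g₂ W w j) :
    ∃ (W' : Set (State n)) (w' : ℕ → State n → ℝ), IsOpen W' ∧ W'.Nonempty ∧ W' ⊆ W ∧
      IsPartialChain U g₁ g₂ W' w' (j + 1) := by
  obtain ⟨k, rfl⟩ : ∃ k, n = j + k + 3 := ⟨n - 3 - j, by omega⟩
  have hsm : ∀ k, ∀ X ∈ controlFlag U g₁ g₂ k, ContDiffOn ℝ ∞ X W :=
    fun k X hX => (contDiffOn_of_mem_controlFlag hU hg₁ hg₂ k hX).mono hWU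
  have hmono : ∀ {k l : ℕ}, k ≤ l → ∀ x, (controlFlag U g₁ g₂ k).atPoint x ≤
      (controlFlag U g₁ g₂ l).atPoint x := by
    rintro k l hkl x _ ⟨X, hX, rfl⟩
    exact ⟨X, controlFlag_mono hkl hX, rfl⟩
  have hann : ∀ i < j, ∀ x ∈ W, ∀ v ∈ (controlFlag U g₁ g₂ k).atPoint x,
      fderiv ℝ (w (i + 1)) x v = w (i + 2) x * fderiv ℝ (w 0) x v := fun i hi x hx v hv =>
    h.annihilates i hi (j + k - i) (by omega) x hx v (hmono (by omega) x hv)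
  obtain ⟨p, hp, X, hX, hXp⟩ : ∃ p ∈ W, ∃ X ∈ controlFlag U g₁ g₂ k,
      fderiv ℝ (w 0) p (X p) ≠ 0 := by
    by_contra! hcon
    have hle : ∀ x ∈ W, (controlFlag U g₁ g₂ k).atPoint x ≤ commonKer w (j + 1) x := by
      rintro x hx _ ⟨Y, hY, rfl⟩ (- | i) hi
      · exact hcon x hx Y hY
      · rw [hann i (by omega) x hx _ ⟨Y, hY, rfl⟩, hcon x hx Y hY, mul_zero]
    obtain ⟨q, hq⟩ := hne
    have heq : (controlFlag U g₁ g₂ k).atPoint q = commonKer w (j + 1) q := by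
      refine Submodule.eq_of_le_of_finrank_le (hle q hq) ?_
      have h1 := finrank_le_finrank_inf_ker_add_one (commonKer w (j + 1) q)
        (fderiv ℝ (w (j + 1)) q : State (j + k + 3) →ₗ[ℝ] ℝ)
      rw [← commonKer_succ] at h1
      have h2 : finrank ℝ (commonKer w (j + 1 + 1) q) + (j + 2) ≤ j + k + 3 := h.rank q hq
      rw [hdim k (by omega) q hq]
      omega
    refine not_brackets_mem (hdim k (by omega) q hq) (hdim (k + 1) (by omega) q hq)
      fun Y hY Z hZ => ?_
    rw [heq]
    intro i hi
    exact fderiv_apply_lieBracket_eq_zero hW (h.smooth i (by omega)) (hsm k Y hY) (hsm k Z hZ)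
      (fun x hx => hle x hx ⟨Y, hY, rfl⟩ i hi) (fun x hx => hle x hx ⟨Z, hZ, rfl⟩ i hi) hq
  have hd : ∀ i ≤ j + 1, ContDiffOn ℝ ∞ (fun x => fderiv ℝ (w i) x (X x)) W := fun i hi =>
    ((h.smooth i hi).fderiv_infty_of_isOpen hW).clm_apply (hsm k X hX)
  let W' : Set (State (j + k + 3)) := W ∩ (fun x => fderiv ℝ (w 0) x (X x)) ⁻¹' {0}ᶜ
  have hW' : IsOpen W' := (hd 0 (by omega)).continuousOn.isOpen_inter_preimage hW
    isOpen_compl_singleton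
  have hW'W : W' ⊆ W := inter_subset_left
  let b : State (j + k + 3) → ℝ := fun x => fderiv ℝ (w (j + 1)) x (X x) / fderiv ℝ (w 0) x (X x)
  have hb : ContDiffOn ℝ ∞ b W' :=
    ((hd (j + 1) le_rfl).mono hW'W).div ((hd 0 (by omega)).mono hW'W) fun x hx => hx.2
  let w' : ℕ → State (j + k + 3) → ℝ := Function.update w (j + 2) b
  have hw' : ∀ i ≤ j + 1, w' i = w i := fun i hi => Function.update_of_ne (by omega) _ _
  have hw'b : w' (j + 2) = b := Function.update_self _ _ _
  have hsmooth : ∀ i ≤ j + 1 + 1, ContDiffOn ℝ ∞ (w' i) W' := by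
    intro i hi
    rcases Nat.lt_or_ge (j + 1) i with h1 | h1
    · obtain rfl : i = j + 2 := by omega
      rwa [hw'b]
    · rw [hw' i h1]
      exact (h.smooth i h1).mono hW'W
  have hann' : ∀ i < j + 1, ∀ x ∈ W', ∀ v ∈ (controlFlag U g₁ g₂ k).atPoint x,
      fderiv ℝ (w' (i + 1)) x v = w' (i + 2) x * fderiv ℝ (w' 0) x v := by
    intro i hi x hx v hv
    rw [hw' (i + 1) (by omega), hw' 0 (by omega)]
    rcases Nat.lt_or_ge i j with h1 | h1
    · rw [hw' (i + 2) (by omega)]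
      exact hann i h1 x hx.1 v hv
    · obtain rfl : i = j := by omega
      rw [hw'b]
      have h2 := h.wedge k rfl x hx.1 (X x) ⟨X, hX, rfl⟩ v hv
      have h3 : fderiv ℝ (w 0) x (X x) ≠ 0 := hx.2
      simp only [b]
      field_simp
      linarith
  have hbracket : ∀ i < j + 1, ∀ l ≤ k, ∀ A ∈ controlFlag U g₁ g₂ l, ∀ B ∈ controlFlag U g₁ g₂ l,
      ∀ x ∈ W', fderiv ℝ (w' (i + 1)) x (lieBracket ℝ A B x) -
          w' (i + 2) x * fderiv ℝ (w' 0) x (lieBracket ℝ A B x) =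
        fderiv ℝ (w' (i + 2)) x (A x) * fderiv ℝ (w' 0) x (B x) -
          fderiv ℝ (w' (i + 2)) x (B x) * fderiv ℝ (w' 0) x (A x) :=
    fun i hi l hl A hA B hB x hx => sub_smul_apply_lieBracket hW' (hsmooth _ (by omega))
      (hsmooth _ (by omega)) (hsmooth _ (by omega)) ((hsm l A hA).mono hW'W)
      ((hsm l B hB).mono hW'W)
      (fun y hy => hann' i hi y hy _ (hmono hl y ⟨A, hA, rfl⟩))
      (fun y hy => hann' i hi y hy _ (hmono hl y ⟨B, hB, rfl⟩)) hx
  refine ⟨W', w', hW', ⟨p, hp, hXp⟩, hW'W, hsmooth, ?_, ?_, ?_⟩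
  · intro x hx
    have hker : commonKer w' (j + 2) x = commonKer w (j + 2) x := by
      ext v
      simp only [mem_commonKer]
      exact forall₂_congr fun i hi => by rw [hw' i (by omega)]
    have hr := h.rank x hx.1
    rw [← hker] at hr
    have hlt : commonKer w' (j + 3) x < commonKer w' (j + 2) x := by
      rw [commonKer_succ]
      refine lt_of_le_of_ne inf_le_left fun heq => ?_
      have hvan : ∀ v ∈ commonKer w' (j + 2) x, fderiv ℝ (w' (j + 2)) x v = 0 := fun v hv => by
        rw [← heq] at hv
        exact hv.2
      -- The common kernel of the forms `dw_{i+1} - w_{i+2} ds`, `i ≤ j`, is `H`.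
      let K : Submodule ℝ (State (j + k + 3)) :=
        { carrier := {v | ∀ i < j + 1, fderiv ℝ (w' (i + 1)) x v =
            w' (i + 2) x * fderiv ℝ (w' 0) x v}
          add_mem' := fun h1 h2 i hi => by simp only [map_add, h1 i hi, h2 i hi, mul_add]
          zero_mem' := fun _ _ => by simp
          smul_mem' := fun c v h i hi => by
            simp only [map_smul, h i hi, smul_eq_mul]
            ring }
      have hHK : (controlFlag U g₁ g₂ k).atPoint x ≤ K := fun v hv i hi => hann' i hi x hx v hv
      have hKs : K ⊓ LinearMap.ker (fderiv ℝ (w' 0) x : State (j + k + 3) →ₗ[ℝ] ℝ) ≤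
          commonKer w' (j + 2) x := by
        rintro v ⟨hv, hv0⟩ (- | i) hi
        · exact hv0
        · have h0 : fderiv ℝ (w' 0) x v = 0 := hv0
          rw [hv i (by omega), h0, mul_zero]
      have hHK' : (controlFlag U g₁ g₂ k).atPoint x = K := by
        refine Submodule.eq_of_le_of_finrank_le hHK ?_
        have h1 := finrank_le_finrank_inf_ker_add_one K
          (fderiv ℝ (w' 0) x : State (j + k + 3) →ₗ[ℝ] ℝ)
        have h2 := Submodule.finrank_mono hKs
        rw [hdim k (by omega) x hx.1]
        omega
      refine not_brackets_mem (hdim k (by omega) x hx.1) (hdim (k + 1) (by omega) x hx.1)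
        fun A hA B hB => ?_
      rw [hHK']
      intro i hi
      have hA' : A x ∈ (controlFlag U g₁ g₂ k).atPoint x := ⟨A, hA, rfl⟩
      have hB' : B x ∈ (controlFlag U g₁ g₂ k).atPoint x := ⟨B, hB, rfl⟩
      rw [← sub_eq_zero, hbracket i hi k le_rfl A hA B hB x hx]
      rcases Nat.lt_or_ge i j with h1 | h1
      · rw [hann' (i + 1) (by omega) x hx _ hA', hann' (i + 1) (by omega) x hx _ hB']
        ring
      · obtain rfl : i = j := by omega
        have hv : fderiv ℝ (w' 0) x (B x) • A x - fderiv ℝ (w' 0) x (A x) • B x ∈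
            commonKer w' (i + 2) x := by
          refine hKs ⟨K.sub_mem (K.smul_mem _ (hHK hA')) (K.smul_mem _ (hHK hB')), ?_⟩
          simp only [SetLike.mem_coe, LinearMap.mem_ker, map_sub, map_smul, smul_eq_mul,
            ContinuousLinearMap.coe_coe]
          ring
        have h4 := hvan _ hv
        simp only [map_sub, map_smul, smul_eq_mul] at h4
        linarith
    have := Submodule.finrank_lt_finrank_of_lt hlt
    change finrank ℝ (commonKer w' (j + 3) x) + (j + 3) ≤ _
    omega
  · intro i hi l hl x hx v hv
    rcases Nat.lt_or_ge i j with h1 | h1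
    · rw [hw' (i + 1) (by omega), hw' (i + 2) (by omega), hw' 0 (by omega)]
      exact h.annihilates i h1 l hl x hx.1 v hv
    · obtain rfl : i = j := by omega
      obtain rfl : l = k := by omega
      exact hann' i hi x hx v hv
  · rintro l hl x hx _ ⟨A, hA, rfl⟩ _ ⟨B, hB, rfl⟩
    obtain rfl : k = l + 1 := by omega
    change fderiv ℝ (w' (j + 2)) x (A x) * _ - fderiv ℝ (w' (j + 2)) x (B x) * _ = 0
    rw [← hbracket j (by omega) l (by omega) A hA B hB x hx,
      hann' j (by omega) x hx _ ⟨_, lieBracket_mem_controlFlag hA hB, rfl⟩, sub_self]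

/-- Every open set on which the derived flag has the generic dimensions contains a nonempty open set
with chained coordinates. -/
theorem exists_partialChain (hU : IsOpen U) (hg₁ : ContDiffOn ℝ ∞ g₁ U)
    (hg₂ : ContDiffOn ℝ ∞ g₂ U) {W : Set (State n)} (hW : IsOpen W) (hWU : W ⊆ U)
    (hdim : ∀ k, k + 2 ≤ n → ∀ q ∈ W, finrank ℝ ((controlFlag U g₁ g₂ k).atPoint q) = 2 + k)
    (hne : W.Nonempty) {j : ℕ} (hj : j + 2 ≤ n) :
    ∃ (W' : Set (State n)) (w : ℕ → State n → ℝ), IsOpen W' ∧ W'.Nonempty ∧ W' ⊆ W ∧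
      IsPartialChain U g₁ g₂ W' w j := by
  induction j with
  | zero =>
    rcases Nat.lt_or_ge 2 n with h3 | h3
    · obtain ⟨p, hp⟩ := hne
      exact exists_partialChain_zero hU hg₁ hg₂ hW hWU hdim h3 hp
    · -- In dimension two any coordinates will do.
      obtain rfl : n = 2 := by omega
      let w : ℕ → State 2 → ℝ := fun i x => if i = 0 then x 0 else x 1
      have hw0 : w 0 = ContinuousLinearMap.proj (R := ℝ) (φ := fun _ : Fin 2 => ℝ) 0 := rfl
      have hw1 : w 1 = ContinuousLinearMap.proj (R := ℝ) (φ := fun _ : Fin 2 => ℝ) 1 := rfl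
      refine ⟨W, w, hW, hne, subset_rfl, ?_, ?_, fun i hi => absurd hi (by omega),
        fun k hk => absurd hk (by omega)⟩
      · intro i hi
        interval_cases i
        · rw [hw0]
          exact (ContinuousLinearMap.contDiff _).contDiffOn
        · rw [hw1]
          exact (ContinuousLinearMap.contDiff _).contDiffOn
      · intro x _
        have h0 : commonKer w (0 + 2) x = ⊥ := by
          rw [eq_bot_iff]
          intro v hv
          have e0 := hv 0 (by omega)
          have e1 := hv 1 (by omega)
          rw [hw0, ContinuousLinearMap.fderiv] at e0
          rw [hw1, ContinuousLinearMap.fderiv] at e1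
          rw [Submodule.mem_bot]
          ext i
          fin_cases i
          · exact e0
          · exact e1
        rw [h0, finrank_bot]
  | succ j ih =>
    obtain ⟨W₁, w, hW₁, hne₁, hW₁W, hw⟩ := ih (by omega)
    obtain ⟨W₂, w', hW₂, hne₂, hW₂₁, hw'⟩ := hw.exists_succ hU hg₁ hg₂ hW₁ (hW₁W.trans hWU)
      (fun k hk q hq => hdim k hk q (hW₁W hq)) hne₁ (by omega)
    exact ⟨W₂, w', hW₂, hne₂, hW₂₁.trans hW₁W, hw'⟩

end Chained

/-! ### The drift in chained coordinates -/

section Drift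

open Set Filter Topology VectorField Module

variable {n : ℕ}

/-- The coordinates `z = (w₁, …, w_{n-1}, w₀)` given by a chain of functions. -/
def chainMap (w : ℕ → State n → ℝ) (x : State n) : State n :=
  fun l => if (l : ℕ) + 1 = n then w 0 x else w (l + 1) x

section

variable {W : Set (State n)} {w : ℕ → State n → ℝ}

theorem contDiffOn_chainMap (hw : ∀ i < n, ContDiffOn ℝ ∞ (w i) W) :
    ContDiffOn ℝ ∞ (chainMap w) W := by
  rw [contDiffOn_pi]
  intro l
  by_cases hl : (l : ℕ) + 1 = n
  · simpa only [chainMap, hl, if_true] using hw 0 (by omega)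
  · simpa only [chainMap, hl, if_false] using hw (l + 1) (by omega)

theorem fderiv_chainMap_apply (hW : IsOpen W) (hw : ∀ i < n, ContDiffOn ℝ ∞ (w i) W)
    {x : State n} (hx : x ∈ W) (v : State n) (l : Fin n) :
    fderiv ℝ (chainMap w) x v l =
      if (l : ℕ) + 1 = n then fderiv ℝ (w 0) x v else fderiv ℝ (w (l + 1)) x v := by
  have h1 := hasFDerivAt_pi'.1
    ((contDiffOn_chainMap hw).differentiableAt_of_isOpen hW hx).hasFDerivAt l
  have h2 : fderiv ℝ (fun y => chainMap w y l) x v = fderiv ℝ (chainMap w) x v l := by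
    rw [h1.fderiv]
    rfl
  rw [← h2]
  by_cases hl : (l : ℕ) + 1 = n <;> simp only [chainMap, hl, if_true, if_false]

theorem exists_equiv_fderiv_chainMap (hW : IsOpen W) (hw : ∀ i < n, ContDiffOn ℝ ∞ (w i) W)
    {x : State n} (hx : x ∈ W) (hker : finrank ℝ (commonKer w n x) = 0) :
    ∃ e : State n ≃L[ℝ] State n, fderiv ℝ (chainMap w) x = e := by
  have hinj : Function.Injective (fderiv ℝ (chainMap w) x : State n →ₗ[ℝ] State n) := by
    rw [← LinearMap.ker_eq_bot, eq_bot_iff, ← Submodule.finrank_eq_zero.1 hker]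
    intro v hv i hi
    have h0 : fderiv ℝ (chainMap w) x v = 0 := hv
    rcases i with - | i
    · have h1 := congrFun h0 ⟨n - 1, by omega⟩
      rwa [fderiv_chainMap_apply hW hw hx, if_pos (by simp only; omega)] at h1
    · have h1 := congrFun h0 ⟨i, by omega⟩
      rwa [fderiv_chainMap_apply hW hw hx, if_neg (by simp only; omega)] at h1
  exact ⟨(LinearEquiv.ofInjectiveEndo _ hinj).toContinuousLinearEquiv,
    ContinuousLinearMap.ext fun _ => rfl⟩

theorem finrank_commonKer_add_le {m N : ℕ} {x : State n} (h : finrank ℝ (commonKer w N x) + N ≤ n)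
    (hm : m ≤ N) : finrank ℝ (commonKer w m x) + m ≤ n := by
  induction N, hm using Nat.le_induction with
  | base => exact h
  | succ N _ ih =>
    have h1 := finrank_le_finrank_inf_ker_add_one (commonKer w N x)
      (fderiv ℝ (w N) x : State n →ₗ[ℝ] ℝ)
    rw [← commonKer_succ] at h1
    exact ih (by omega)

end

variable {U : Set (State n)} {f g₁ g₂ : VecField n}

/-- Forms annihilating a distribution over a smaller open set extend to `U`, up to restriction to a
neighbourhood of a given point. -/
theorem exists_mem_annihilator_eventuallyEq {W : Set (State n)} (hW : IsOpen W)
    {Δ : VecDistribution U} {θ : OneForm n} (hθ : ContDiffOn ℝ ∞ θ W)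
    (h : ∀ X ∈ Δ, ∀ x ∈ W, θ x (X x) = 0) {q : State n} (hq : q ∈ W) :
    ∃ η ∈ Δ.annihilator, η =ᶠ[𝓝 q] θ := by
  obtain ⟨χ, W', hW', hq', -, hχ1, hχ0, hs⟩ := exists_contDiff_smul_of_contDiffOn hW hθ hq
  refine ⟨fun x => χ x • θ x, ⟨hs.contDiffOn, fun X hX x hx => ?_⟩, ?_⟩
  · by_cases hxW : x ∈ W
    · simp [h X hX x hxW]
    · simp [hχ0 x hxW]
  · filter_upwards [hW'.mem_nhds hq'] with x hx
    rw [hχ1 x hx, one_smul]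

/-- In chained coordinates the drift component `dw_{i+1}(f) - w_{i+2} ds(f)`, `i = n - 3 - k`, does
not depend on the variables other than `s, w₁, …, w_{i+2}`: the vectors `v` killed by their
differentials are Cauchy characteristics of `(G_k)^⊥`, so that the Lie derivative along `f` of the
form `dw_{i+1} - w_{i+2} ds` vanishes on them. -/
theorem IsPartialChain.fderiv_drift_eq_zero (hU : IsOpen U) (hf : ContDiffOn ℝ ∞ f U)
    (hg₁ : ContDiffOn ℝ ∞ g₁ U) (hg₂ : ContDiffOn ℝ ∞ g₂ U) {W : Set (State n)} (hW : IsOpen W)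
    (hWU : W ⊆ U)
    (hdim : ∀ k, k + 2 ≤ n → ∀ q ∈ W, finrank ℝ ((controlFlag U g₁ g₂ k).atPoint q) = 2 + k)
    {w : ℕ → State n → ℝ} {j : ℕ} (hj : j + 2 = n) (h : IsPartialChain U g₁ g₂ W w j)
    {i k : ℕ} (hik : i + k + 3 = n) {q : State n} (hq : q ∈ W)
    (hLie : ∀ θ ∈ (controlFlag U g₁ g₂ k).annihilator,
      lieDerivOneForm f θ q ∈ (controlFlag U g₁ g₂ k).annihilator.retracting q)
    {v : State n} (hv : v ∈ commonKer w (i + 3) q) :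
    fderiv ℝ (fun x => fderiv ℝ (w (i + 1)) x (f x) - w (i + 2) x * fderiv ℝ (w 0) x (f x)) q v
      = 0 := by
  have hsm : ∀ l < n, ContDiffOn ℝ ∞ (w l) W := fun l hl => h.smooth l (by omega)
  have hX : ∀ X ∈ controlFlag U g₁ g₂ k, ContDiffOn ℝ ∞ X W :=
    fun X hX => (contDiffOn_of_mem_controlFlag hU hg₁ hg₂ k hX).mono hWU
  have hrank : ∀ x ∈ W, finrank ℝ (commonKer w n x) + n ≤ n := fun x hx => by
    have := h.rank x hx
    rwa [hj] at this
  let θ : ℕ → OneForm n := fun l x => fderiv ℝ (w (l + 1)) x - w (l + 2) x • fderiv ℝ (w 0) x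
  have hθ : ∀ l ≤ i, ContDiffOn ℝ ∞ (θ l) W := fun l hl =>
    ((hsm (l + 1) (by omega)).fderiv_infty_of_isOpen hW).sub
      ((hsm (l + 2) (by omega)).smul ((hsm 0 (by omega)).fderiv_infty_of_isOpen hW))
  have hθ0 : ∀ l x u, θ l x u = 0 ↔ fderiv ℝ (w (l + 1)) x u = w (l + 2) x * fderiv ℝ (w 0) x u :=
    fun l x u => by simp [θ, sub_eq_zero]
  -- `G_k(x)` is the common kernel of the forms `θ_l`, `l ≤ i`.
  have hker : ∀ x ∈ W, ∀ u, u ∈ (controlFlag U g₁ g₂ k).atPoint x ↔ ∀ l ≤ i, θ l x u = 0 := by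
    intro x hx
    let K : Submodule ℝ (State n) :=
      { carrier := {u | ∀ l ≤ i, θ l x u = 0}
        add_mem' := fun h1 h2 l hl => by rw [map_add, h1 l hl, h2 l hl, add_zero]
        zero_mem' := fun _ _ => map_zero _
        smul_mem' := fun c u h l hl => by rw [map_smul, h l hl, smul_zero] }
    have hle : (controlFlag U g₁ g₂ k).atPoint x ≤ K := by
      rintro _ ⟨X, hX, rfl⟩ l hl
      exact (hθ0 l x _).2 (h.annihilates l (by omega) (k + i - l) (by omega) x hx _
        ⟨X, controlFlag_mono (by omega) hX, rfl⟩)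
    have hKs : K ⊓ LinearMap.ker (fderiv ℝ (w 0) x : State n →ₗ[ℝ] ℝ) ≤ commonKer w (i + 2) x := by
      rintro u ⟨hu, hu0⟩ (- | l) hl
      · exact hu0
      · have h0 : fderiv ℝ (w 0) x u = 0 := hu0
        rw [(hθ0 l x u).1 (hu l (by omega)), h0, mul_zero]
    have heq : (controlFlag U g₁ g₂ k).atPoint x = K := by
      refine Submodule.eq_of_le_of_finrank_le hle ?_
      have h1 := finrank_le_finrank_inf_ker_add_one K (fderiv ℝ (w 0) x : State n →ₗ[ℝ] ℝ)
      have h2 := Submodule.finrank_mono hKs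
      have h3 := finrank_commonKer_add_le (m := i + 2) (hrank x hx) (by omega)
      rw [hdim k (by omega) x hx]
      omega
    intro u
    rw [heq]
    rfl
  have hcK : ∀ x ∈ W, ∀ u ∈ commonKer w (i + 3) x, u ∈ (controlFlag U g₁ g₂ k).atPoint x :=
    fun x hx u hu => (hker x hx u).2 fun l hl => (hθ0 l x u).2 (by
      rw [hu (l + 1) (by omega), hu 0 (by omega), mul_zero])
  have hmem : ∀ l ≤ i, ∃ η ∈ (controlFlag U g₁ g₂ k).annihilator, η =ᶠ[𝓝 q] θ l := fun l hl =>
    exists_mem_annihilator_eventuallyEq hW (hθ l hl)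
      (fun X hX x hx => (hker x hx _).1 ⟨X, hX, rfl⟩ l hl) hq
  -- A vector field extending `v`, with constant components in the chained coordinates.
  obtain ⟨e, he⟩ := exists_equiv_fderiv_chainMap hW hsm hq (by have := hrank q hq; omega)
  let V : VecField n := fun x => (fderiv ℝ (chainMap w) x).inverse (fderiv ℝ (chainMap w) q v)
  have hVq : V q = v := by
    change (fderiv ℝ (chainMap w) q).inverse (fderiv ℝ (chainMap w) q v) = v
    rw [he, ContinuousLinearMap.inverse_equiv]
    exact e.symm_apply_apply v
  have hVd : ∀ x ∈ W, fderiv ℝ (chainMap w) x (V x) = fderiv ℝ (chainMap w) q v := by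
    intro x hx
    obtain ⟨e', he'⟩ := exists_equiv_fderiv_chainMap hW hsm hx (by have := hrank x hx; omega)
    simp only [V]
    rw [he', ContinuousLinearMap.inverse_equiv]
    exact e'.apply_symm_apply _
  have hVs : ContDiffOn ℝ ∞ V W := by
    refine ContDiffOn.clm_apply (fun x hx => ?_) contDiffOn_const
    obtain ⟨e', he'⟩ := exists_equiv_fderiv_chainMap hW hsm hx (by have := hrank x hx; omega)
    refine ContDiffAt.comp_contDiffWithinAt x (g := ContinuousLinearMap.inverse) ?_
      (((contDiffOn_chainMap hsm).fderiv_infty_of_isOpen hW) x hx)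
    rw [he']
    exact contDiffAt_map_inverse e'
  have hVker : ∀ x ∈ W, V x ∈ commonKer w (i + 3) x := by
    rintro x hx (- | l) hl
    · have h1 := congrFun (hVd x hx) ⟨n - 1, by omega⟩
      rw [fderiv_chainMap_apply hW hsm hx, fderiv_chainMap_apply hW hsm hq,
        if_pos (by simp only; omega), if_pos (by simp only; omega)] at h1
      rw [h1, hv 0 hl]
    · by_cases hl' : l + 1 = n
      · omega
      · have h1 := congrFun (hVd x hx) ⟨l, by omega⟩
        rw [fderiv_chainMap_apply hW hsm hx, fderiv_chainMap_apply hW hsm hq,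
          if_neg (by simpa using hl'), if_neg (by simpa using hl')] at h1
        simp only at h1
        rw [h1, hv (l + 1) hl]
  have hassoc : v ∈ (controlFlag U g₁ g₂ k).annihilator.associated q := by
    rintro η ⟨hηs, hη⟩
    have hηk : ∀ x ∈ W, ∀ u ∈ (controlFlag U g₁ g₂ k).atPoint x, η x u = 0 := by
      rintro x hx _ ⟨X, hX, rfl⟩
      exact hη X hX x (hWU hx)
    refine ⟨hηk q hq v (hcK q hq v hv), ?_⟩
    have hvan : ∀ u ∈ (controlFlag U g₁ g₂ k).atPoint q, contractExtDeriv η q v u = 0 := by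
      rintro _ ⟨Y, hY, rfl⟩
      have h1 := apply_lieBracket_eq_neg_contractExtDeriv
        ((hηs.mono hWU).differentiableAt_of_isOpen hW hq)
        (hVs.differentiableAt_of_isOpen hW hq) ((hX Y hY).differentiableAt_of_isOpen hW hq)
        (eventually_of_mem (hW.mem_nhds hq) fun x hx => hηk x hx _ (hcK x hx _ (hVker x hx)))
        (eventually_of_mem (hW.mem_nhds hq) fun x hx => hη Y hY x (hWU hx))
      have h2 : lieBracket ℝ V Y q ∈ (controlFlag U g₁ g₂ k).atPoint q := by
        refine (hker q hq _).2 fun l hl => ?_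
        have h3 := sub_smul_apply_lieBracket hW (hsm (l + 1) (by omega)) (hsm (l + 2) (by omega))
          (hsm 0 (by omega)) hVs (hX Y hY)
          (fun x hx => (hθ0 l x _).1 ((hker x hx _).1 (hcK x hx _ (hVker x hx)) l hl))
          (fun x hx => (hθ0 l x _).1 ((hker x hx _).1 ⟨Y, hY, rfl⟩ l hl)) hq
        rw [hVq, hv (l + 2) (by omega), hv 0 (by omega), zero_mul, mul_zero, sub_zero] at h3
        exact (hθ0 l q _).2 (sub_eq_zero.1 h3)
      rw [hηk q hq _ h2, hVq] at h1
      linarith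
    have hspan := mem_span_of_iInf_ker_le_ker
      (L := fun l : Fin (i + 1) => (θ l q : State n →ₗ[ℝ] ℝ))
      (K := (contractExtDeriv η q v : State n →ₗ[ℝ] ℝ)) (by
        intro u hu
        rw [Submodule.mem_iInf] at hu
        exact hvan u ((hker q hq u).2 fun l hl => hu ⟨l, by omega⟩))
    obtain ⟨c, hc⟩ := (Submodule.mem_span_range_iff_exists_fun ℝ).1 hspan
    have hc' : contractExtDeriv η q v = ∑ l, c l • θ l q := by
      ext u
      have := LinearMap.congr_fun hc u
      simpa using this.symm
    rw [hc']
    refine Submodule.sum_mem _ fun l _ => Submodule.smul_mem _ _ ?_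
    obtain ⟨η', hη', heq⟩ := hmem l (by omega)
    exact ⟨η', hη', heq.eq_of_nhds⟩
  obtain ⟨η, hη, heq⟩ := hmem i le_rfl
  have h1 : lieDerivOneForm f η q v = 0 := hLie η hη v hassoc
  rw [lieDerivOneForm, heq.fderiv_eq, heq.eq_of_nhds] at h1
  have hdf := ((hf.mono hWU).differentiableAt_of_isOpen hW hq).hasFDerivAt
  have hdθ := ((hθ i le_rfl).differentiableAt_of_isOpen hW hq).hasFDerivAt
  have h2 : fderiv ℝ (fun x => θ i x (f x)) q v =
      θ i q (fderiv ℝ f q v) + fderiv ℝ (θ i) q v (f q) := by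
    rw [(hdθ.clm_apply hdf).fderiv]
    simp
  have h3 := contractExtDeriv_sub_smul hW (hsm (i + 1) (by omega)) (hsm (i + 2) (by omega))
    (hsm 0 (by omega)) hq v (f q)
  rw [hv (i + 2) (by omega), hv 0 (by omega), zero_mul, mul_zero, sub_zero, neg_zero] at h3
  have h4 : contractExtDeriv (θ i) q v (f q) = 0 := h3
  rw [contractExtDeriv_apply] at h4
  have h5 : fderiv ℝ (θ i) q (f q) v + θ i q (fderiv ℝ f q v) = 0 := h1
  change fderiv ℝ (fun x => θ i x (f x)) q v = 0
  rw [h2]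
  linarith

end Drift

/-! ### The triangular form -/

section Triangular

open Set Filter Topology VectorField Module

variable {n : ℕ}

/-- A smooth diffeomorphism around `p` can be restricted to have a ball as its target. -/
theorem exists_restrict_target_eq_ball {φ : OpenPartialHomeomorph (State n) (State n)}
    {p : State n} (hp : p ∈ φ.source) :
    ∃ (ψ : OpenPartialHomeomorph (State n) (State n)) (r : ℝ), 0 < r ∧
      (ψ : State n → State n) = φ ∧ (ψ.symm : State n → State n) = φ.symm ∧ p ∈ ψ.source ∧
      ψ.source ⊆ φ.source ∧ ψ.target ⊆ φ.target ∧ ψ.target = Metric.ball (φ p) r := by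
  obtain ⟨r, hr, hball⟩ := Metric.isOpen_iff.1 φ.open_target (φ p) (φ.map_source hp)
  let ψ := (φ.symm.restrOpen (Metric.ball (φ p) r) Metric.isOpen_ball).symm
  have ht : ψ.target = φ.target ∩ Metric.ball (φ p) r := rfl
  refine ⟨ψ, r, hr, rfl, rfl, ⟨hp, ?_⟩, fun x hx => hx.1, fun x hx => hx.1, ?_⟩
  · exact Metric.mem_ball_self hr
  · rw [ht, inter_eq_right.2 hball]

open Classical in
/-- Replaces the coordinates outside `S` by those of `c`. -/
def freezeCoords (S : Set (Fin n)) (c z : State n) : State n := fun l => if l ∈ S then z l else c l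

theorem contDiff_freezeCoords (S : Set (Fin n)) (c : State n) :
    ContDiff ℝ ∞ (freezeCoords S c) := by
  rw [contDiff_pi]
  intro l
  by_cases hl : l ∈ S
  · simpa only [freezeCoords, hl, if_true] using contDiff_apply ℝ ℝ l
  · simpa only [freezeCoords, hl, if_false] using contDiff_const

theorem freezeCoords_mem_ball {S : Set (Fin n)} {c z : State n} {r : ℝ}
    (hz : z ∈ Metric.ball c r) : freezeCoords S c z ∈ Metric.ball c r := by
  have hr : 0 < r := dist_nonneg.trans_lt hz
  rw [Metric.mem_ball, dist_pi_lt_iff hr] at hz ⊢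
  intro l
  by_cases hl : l ∈ S
  · simpa only [freezeCoords, hl, if_true] using hz l
  · simpa only [freezeCoords, hl, if_false, dist_self] using hr

/-- On a ball for the sup norm, that is, on a box, a function whose partial derivatives in the
directions outside `S` vanish depends only on the coordinates in `S`. -/
theorem apply_freezeCoords {S : Set (Fin n)} {c : State n} {r : ℝ} {G : State n → ℝ}
    (hG : DifferentiableOn ℝ G (Metric.ball c r))
    (h : ∀ y ∈ Metric.ball c r, ∀ d : State n, (∀ l ∈ S, d l = 0) → fderiv ℝ G y d = 0)
    {z : State n} (hz : z ∈ Metric.ball c r) : G (freezeCoords S c z) = G z := by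
  set y := freezeCoords S c z with hy
  have hyB : y ∈ Metric.ball c r := freezeCoords_mem_ball hz
  have hd : ∀ l ∈ S, (z - y) l = 0 := fun l hl => by simp [hy, freezeCoords, hl]
  have hmem : ∀ t ∈ Icc (0 : ℝ) 1, y + t • (z - y) ∈ Metric.ball c r := fun t ht =>
    (convex_ball c r).add_smul_sub_mem hyB hz ht
  have hder : ∀ t ∈ Icc (0 : ℝ) 1, HasDerivAt (fun t : ℝ => G (y + t • (z - y))) 0 t := by
    intro t ht
    have h1 : HasDerivAt (fun t : ℝ => y + t • (z - y)) (z - y) t := by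
      simpa using ((hasDerivAt_id t).smul_const (z - y)).const_add y
    have h2 := ((hG _ (hmem t ht)).differentiableAt
      (Metric.isOpen_ball.mem_nhds (hmem t ht))).hasFDerivAt.comp_hasDerivAt t h1
    rwa [h _ (hmem t ht) _ hd] at h2
  have := constant_of_has_deriv_right_zero
    (fun t ht => (hder t ht).continuousAt.continuousWithinAt)
    (fun t ht => (hder t (Ico_subset_Icc_self ht)).hasDerivWithinAt) 1 ⟨zero_le_one, le_rfl⟩
  simpa using this.symm

variable {U : Set (State n)} {f g₁ g₂ : VecField n}

/-- Chained coordinates put the system into triangular form: the feedback makes `ds/dt` and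
`dw_{n-1}/dt` the new controls. -/
theorem IsPartialChain.triangularAround (hn : 2 ≤ n) (hU : IsOpen U) (hf : ContDiffOn ℝ ∞ f U)
    (hg₁ : ContDiffOn ℝ ∞ g₁ U) (hg₂ : ContDiffOn ℝ ∞ g₂ U) {W : Set (State n)} (hW : IsOpen W)
    (hWU : W ⊆ U)
    (hdim : ∀ k, k + 2 ≤ n → ∀ q ∈ W, finrank ℝ ((controlFlag U g₁ g₂ k).atPoint q) = 2 + k)
    (hLie : ∀ k, 1 ≤ k → k + 3 ≤ n → ∀ q ∈ W, ∀ θ ∈ (controlFlag U g₁ g₂ k).annihilator,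
      lieDerivOneForm f θ q ∈ (controlFlag U g₁ g₂ k).annihilator.retracting q)
    {w : ℕ → State n → ℝ} {j : ℕ} (hj : j + 2 = n) (h : IsPartialChain U g₁ g₂ W w j)
    {p : State n} (hp : p ∈ W) : TriangularAround U f g₁ g₂ p := by
  have hsm : ∀ l < n, ContDiffOn ℝ ∞ (w l) W := fun l hl => h.smooth l (by omega)
  have hrank : ∀ x ∈ W, finrank ℝ (commonKer w n x) = 0 := fun x hx => by
    have := h.rank x hx
    rw [hj] at this
    omega
  obtain ⟨e, he⟩ := exists_equiv_fderiv_chainMap hW hsm hp (hrank p hp)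
  obtain ⟨φ₀, hφ₀, hpφ₀, hφ₀W, hφ₀s⟩ := exists_openPartialHomeomorph_contDiffOn hW
    (contDiffOn_chainMap hsm) hp e he
  obtain ⟨φ, r, -, hφφ₀, hφsymm, hpφ, hφs, hφt, hφball⟩ := exists_restrict_target_eq_ball hpφ₀
  have hφ : (φ : State n → State n) = chainMap w := hφφ₀.trans hφ₀
  have hφW : φ.source ⊆ W := hφs.trans hφ₀W
  have hsymm : ContDiffOn ℝ ∞ φ.symm φ.target := by
    rw [hφsymm]
    exact hφ₀s.mono hφt
  have hdφ : ∀ x ∈ φ.source, ∀ v l, fderiv ℝ φ x v l =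
      if (l : ℕ) + 1 = n then fderiv ℝ (w 0) x v else fderiv ℝ (w (l + 1)) x v := by
    intro x hx v l
    rw [hφ]
    exact fderiv_chainMap_apply hW hsm (hφW hx) v l
  have hdw : ∀ l < n, ∀ {X : VecField n}, ContDiffOn ℝ ∞ X U →
      ContDiffOn ℝ ∞ (fun x => fderiv ℝ (w l) x (X x)) φ.source := fun l hl X hX =>
    (((hsm l hl).fderiv_infty_of_isOpen hW).clm_apply (hX.mono hWU)).mono hφW
  -- The control fields in the chained coordinates.
  have hg0 : ∀ x ∈ W, ∀ X ∈ Submodule.span ℝ {g₁ x, g₂ x}, ∀ l, l + 2 < n →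
      fderiv ℝ (w (l + 1)) x X = w (l + 2) x * fderiv ℝ (w 0) x X := by
    intro x hx X hX l hl
    refine h.annihilates l (by omega) (n - 3 - l) (by omega) x hx X ?_
    have hle : Submodule.span ℝ {g₁ x, g₂ x} ≤
        (controlFlag U g₁ g₂ (n - 3 - l)).atPoint x := by
      rw [Submodule.span_le]
      rintro _ (rfl | rfl)
      · exact ⟨g₁, controlFlag_mono (Nat.zero_le _) (Submodule.subset_span (by simp)), rfl⟩
      · exact ⟨g₂, controlFlag_mono (Nat.zero_le _) (Submodule.subset_span (by simp)), rfl⟩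
    exact hle hX
  have hspan : ∀ x ∈ W, ∀ c d : ℝ, c • g₁ x + d • g₂ x ∈ Submodule.span ℝ {g₁ x, g₂ x} :=
    fun x _ c d => Submodule.mem_span_pair.2 ⟨c, d, rfl⟩
  have hindep : ∀ x ∈ W, LinearIndependent ℝ ![g₁ x, g₂ x] := by
    intro x hx
    rw [linearIndependent_iff_card_le_finrank_span, Fintype.card_fin, Matrix.range_cons,
      Matrix.range_cons, Matrix.range_empty, union_empty, singleton_union, Set.finrank]
    have h1 : (controlFlag U g₁ g₂ 0).atPoint x ≤ Submodule.span ℝ {g₁ x, g₂ x} := by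
      rintro _ ⟨X, hX, rfl⟩
      change X ∈ Submodule.span _ _ at hX
      induction hX using Submodule.span_induction with
      | mem X hX =>
        rcases hX with rfl | rfl
        · exact Submodule.subset_span (by simp)
        · exact Submodule.subset_span (by simp)
      | zero => exact Submodule.zero_mem _
      | add X Y _ _ hX hY => exact Submodule.add_mem _ hX hY
      | smul a X _ hX => exact Submodule.smul_mem _ _ hX
    have h2 := Submodule.finrank_mono h1
    rwa [hdim 0 hn x hx] at h2
  let a : State n → ℝ := fun x => fderiv ℝ (w 0) x (g₁ x)
  let b : State n → ℝ := fun x => fderiv ℝ (w 0) x (g₂ x)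
  let c : State n → ℝ := fun x => fderiv ℝ (w (n - 1)) x (g₁ x)
  let d : State n → ℝ := fun x => fderiv ℝ (w (n - 1)) x (g₂ x)
  let Δ : State n → ℝ := fun x => a x * d x - b x * c x
  have hΔ : ∀ x ∈ W, Δ x ≠ 0 := by
    intro x hx h0
    -- A vector of `G₀(x)` killed by `ds` and `dw_{n-1}` is killed by all differentials.
    have hz : ∀ k l : ℝ, k * a x + l * b x = 0 → k * c x + l * d x = 0 → k = 0 ∧ l = 0 := by
      intro k l h1 h2
      refine LinearIndependent.pair_iff.1 (hindep x hx) k l ?_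
      have h3 : k • g₁ x + l • g₂ x ∈ commonKer w n x := by
        have hs : fderiv ℝ (w 0) x (k • g₁ x + l • g₂ x) = 0 := by
          rw [map_add, map_smul, map_smul]
          exact h1
        rintro (- | i) hi
        · exact hs
        · rcases Nat.lt_or_ge (i + 2) n with h4 | h4
          · rw [hg0 x hx _ (hspan x hx k l) i h4, hs, mul_zero]
          · obtain rfl : i = n - 2 := by omega
            have h5 : n - 2 + 1 = n - 1 := by omega
            rw [h5, map_add, map_smul, map_smul]
            exact h2
      rwa [Submodule.finrank_eq_zero.1 (hrank x hx), Submodule.mem_bot] at h3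
    have h1 := hz (d x) (-c x) (by simp only [Δ] at h0; linarith) (by ring)
    have h2 := hz (b x) (-a x) (by ring) (by simp only [Δ] at h0; linarith)
    have h3 := hz 1 0 (by linarith [h2.2]) (by linarith [h1.2])
    exact one_ne_zero h3.1
  have ha : ContDiffOn ℝ ∞ a φ.source := hdw 0 (by omega) hg₁
  have hb : ContDiffOn ℝ ∞ b φ.source := hdw 0 (by omega) hg₂
  have hc : ContDiffOn ℝ ∞ c φ.source := hdw (n - 1) (by omega) hg₁
  have hd : ContDiffOn ℝ ∞ d φ.source := hdw (n - 1) (by omega) hg₂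
  have hΔs : ContDiffOn ℝ ∞ Δ φ.source := (ha.mul hd).sub (hb.mul hc)
  have hΔ0 : ∀ x ∈ φ.source, Δ x ≠ 0 := fun x hx => hΔ x (hφW hx)
  let f₀ : State n → ℝ := fun x => fderiv ℝ (w 0) x (f x)
  let f₁ : State n → ℝ := fun x => fderiv ℝ (w (n - 1)) x (f x)
  have hf₀ : ContDiffOn ℝ ∞ f₀ φ.source := hdw 0 (by omega) hf
  have hf₁ : ContDiffOn ℝ ∞ f₁ φ.source := hdw (n - 1) (by omega) hf
  -- The drift components and their independence of the later variables.
  let F : ℕ → State n → ℝ := fun i x =>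
    fderiv ℝ (w (i + 1)) x (f x) - w (i + 2) x * fderiv ℝ (w 0) x (f x)
  have hF : ∀ i, i + 2 < n → ContDiffOn ℝ ∞ (F i) φ.source := fun i hi =>
    (hdw (i + 1) (by omega) hf).sub (((hsm (i + 2) (by omega)).mono hφW).mul hf₀)
  have hFs : ∀ i, i + 2 < n → ContDiffOn ℝ ∞ (fun z => F i (φ.symm z)) φ.target := fun i hi =>
    (hF i hi).comp hsymm fun z hz => φ.map_target hz
  have hFd : ∀ i : Fin n, (i : ℕ) + 2 < n → ∀ y ∈ φ.target, ∀ v : State n,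
      (∀ l ∈ allowedVars i, v l = 0) → fderiv ℝ (fun z => F i (φ.symm z)) y v = 0 := by
    intro i hi y hy v hv
    have hx : φ.symm y ∈ φ.source := φ.map_target hy
    have hds : HasFDerivAt φ.symm (fderiv ℝ φ.symm y) y :=
      (hsymm.differentiableAt_of_isOpen φ.open_target hy).hasFDerivAt
    have hdφ' : HasFDerivAt φ (fderiv ℝ φ (φ.symm y)) (φ.symm y) := by
      rw [hφ]
      exact ((contDiffOn_chainMap hsm).differentiableAt_of_isOpen hW (hφW hx)).hasFDerivAt
    have hdF : HasFDerivAt (F i) (fderiv ℝ (F i) (φ.symm y)) (φ.symm y) :=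
      ((hF i hi).differentiableAt_of_isOpen φ.open_source hx).hasFDerivAt
    have h1 : HasFDerivAt (fun z => F i (φ.symm z))
        (fderiv ℝ (F i) (φ.symm y) ∘L fderiv ℝ φ.symm y) y := hdF.comp y hds
    rw [h1.fderiv]
    change fderiv ℝ (F i) (φ.symm y) (fderiv ℝ φ.symm y v) = 0
    set u := fderiv ℝ φ.symm y v with hu
    have h2 : fderiv ℝ φ (φ.symm y) u = v := by
      have h3 : HasFDerivAt (fun z => φ (φ.symm z))
          (fderiv ℝ φ (φ.symm y) ∘L fderiv ℝ φ.symm y) y := hdφ'.comp y hds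
      have h4 : (fun z => φ (φ.symm z)) =ᶠ[𝓝 y] id :=
        eventually_of_mem (φ.open_target.mem_nhds hy) fun z hz => φ.right_inv hz
      exact congrArg (fun T : State n →L[ℝ] State n => T v)
        (h3.unique ((hasFDerivAt_id y).congr_of_eventuallyEq h4))
    have h5 : ∀ l ∈ allowedVars i, (if (l : ℕ) + 1 = n then fderiv ℝ (w 0) (φ.symm y) u
        else fderiv ℝ (w (l + 1)) (φ.symm y) u) = 0 := by
      intro l hl
      rw [← hdφ _ hx, h2, hv l hl]
    have h6 : u ∈ commonKer w (i + 3) (φ.symm y) := by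
      rintro (- | l) hl
      · have h7 := h5 ⟨n - 1, by omega⟩ (Or.inr (by simp only; omega))
        rwa [if_pos (by simp only; omega)] at h7
      · have h7 := h5 ⟨l, by omega⟩ (Or.inl (by simp only; omega))
        rwa [if_neg (by simp only; omega)] at h7
    rcases Nat.lt_or_ge ((i : ℕ) + 3) n with h8 | h8
    · obtain ⟨k, hk⟩ : ∃ k, (i : ℕ) + k + 3 = n := ⟨n - 3 - i, by omega⟩
      exact h.fderiv_drift_eq_zero hU hf hg₁ hg₂ hW hWU hdim hj hk (hφW hx)
        (hLie k (by omega) (by omega) _ (hφW hx)) h6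
    · have h9 : (i : ℕ) + 3 = n := by omega
      rw [h9, Submodule.finrank_eq_zero.1 (hrank _ (hφW hx)), Submodule.mem_bot] at h6
      rw [h6, map_zero]
  refine ⟨φ,
    fun x => ![-(d x / Δ x * f₀ x - b x / Δ x * f₁ x), -(-(c x / Δ x) * f₀ x + a x / Δ x * f₁ x)],
    fun x => !![d x / Δ x, -(b x / Δ x); -(c x / Δ x), a x / Δ x],
    fun i z => F i (φ.symm (freezeCoords (allowedVars i) (φ p) z)), hpφ, hφW.trans hWU, ?_, hsymm,
    ?_, ?_, ?_, ?_, ?_⟩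
  · rw [hφ]
    exact (contDiffOn_chainMap hsm).mono hφW
  · rw [contDiffOn_pi]
    intro i
    fin_cases i
    · exact (((hd.div hΔs hΔ0).mul hf₀).sub ((hb.div hΔs hΔ0).mul hf₁)).neg
    · exact (((hc.div hΔs hΔ0).neg.mul hf₀).add ((ha.div hΔs hΔ0).mul hf₁)).neg
  · intro i l
    fin_cases i <;> fin_cases l
    · exact hd.div hΔs hΔ0
    · exact (hb.div hΔs hΔ0).neg
    · exact (hc.div hΔs hΔ0).neg
    · exact ha.div hΔs hΔ0
  · intro x hx
    rw [Matrix.isUnit_iff_isUnit_det, Matrix.det_fin_two_of, isUnit_iff_ne_zero]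
    have h1 := hΔ0 x hx
    have h2 : d x / Δ x * (a x / Δ x) - -(b x / Δ x) * -(c x / Δ x) = (Δ x)⁻¹ := by
      field_simp
      simp only [Δ]
      ring
    rw [h2]
    exact inv_ne_zero h1
  · intro i hi
    refine ⟨?_, ?_⟩
    · refine (hFs i hi).comp (contDiff_freezeCoords _ _).contDiffOn fun z hz => ?_
      rw [hφball, ← hφφ₀] at hz ⊢
      exact freezeCoords_mem_ball hz
    · intro z z' hzz'
      have h1 : freezeCoords (allowedVars i) (φ p) z = freezeCoords (allowedVars i) (φ p) z' := by
        funext l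
        by_cases hl : l ∈ allowedVars i
        · simp only [freezeCoords, hl, if_true]
          exact hzz' l hl
        · simp only [freezeCoords, hl, if_false]
      simp only [h1]
  · intro x hx v u hu
    have hxW := hφW hx
    have h1 := hΔ0 x hx
    have hu0 : u 0 = -(d x / Δ x * f₀ x - b x / Δ x * f₁ x) +
        (d x / Δ x * v 0 + -(b x / Δ x) * v 1) := by
      rw [hu]
      simp [dotProduct, Fin.sum_univ_two]
    have hu1 : u 1 = -(-(c x / Δ x) * f₀ x + a x / Δ x * f₁ x) +
        (-(c x / Δ x) * v 0 + a x / Δ x * v 1) := by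
      rw [hu]
      simp [dotProduct, Fin.sum_univ_two]
    have hv0 : fderiv ℝ (w 0) x (u 0 • g₁ x + u 1 • g₂ x) = v 0 - f₀ x := by
      rw [map_add, map_smul, map_smul]
      change u 0 * a x + u 1 * b x = _
      rw [hu0, hu1]
      field_simp
      simp only [Δ]
      ring
    have hv1 : fderiv ℝ (w (n - 1)) x (u 0 • g₁ x + u 1 • g₂ x) = v 1 - f₁ x := by
      rw [map_add, map_smul, map_smul]
      change u 0 * c x + u 1 * d x = _
      rw [hu0, hu1]
      field_simp
      simp only [Δ]
      ring
    funext i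
    rw [hdφ x hx, add_assoc, triangularRHS]
    rcases Nat.lt_trichotomy ((i : ℕ) + 2) n with hi | hi | hi
    · rw [if_neg (by omega), dif_pos hi, map_add, hg0 x hxW _ (hspan x hxW _ _) i hi, hv0]
      have h2 : F i (φ.symm (freezeCoords (allowedVars i) (φ p) (φ x))) = F i x := by
        have h3 := apply_freezeCoords (S := allowedVars i) (c := φ p) (r := r)
          (G := fun z => F i (φ.symm z))
          (by
            rw [hφφ₀, ← hφball]
            exact (hFs i hi).differentiableOn (by simp))
          (by
            rw [hφφ₀, ← hφball]
            exact hFd i hi)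
          (z := φ x) (by
            have := φ.map_source hx
            rwa [hφball, ← hφφ₀] at this)
        rw [h3, φ.left_inv hx]
      have h4 : φ x ⟨(i : ℕ) + 1, by omega⟩ = w (i + 2) x := by
        rw [hφ]
        exact if_neg (by simp only; omega)
      rw [h2, h4]
      simp only [F, f₀]
      ring
    · have h5 : (i : ℕ) + 1 = n - 1 := by omega
      rw [if_neg (by omega), dif_neg (by omega), if_pos hi, map_add, h5, hv1]
      simp [f₁]
    · rw [if_pos (by omega), dif_neg (by omega), if_neg (by omega), map_add, hv0]
      simp [f₀]

theorem isOpen_setOf_triangularAround : IsOpen {p | TriangularAround U f g₁ g₂ p} := by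
  rw [isOpen_iff_mem_nhds]
  rintro p ⟨φ, α, β, ϕ, hp, h⟩
  filter_upwards [φ.open_source.mem_nhds hp] with q hq
  exact ⟨φ, α, β, ϕ, hq, h⟩

end Triangular

end

theorem corollary1 (n : ℕ) (hn : 2 ≤ n) (U : Set (State n)) (hU : IsOpen U)
    (f g₁ g₂ : VecField n)
    (hf : ContDiffOn ℝ ∞ f U) (hg₁ : ContDiffOn ℝ ∞ g₁ U) (hg₂ : ContDiffOn ℝ ∞ g₂ U)
    (hD : ∃ D : Set (State n), IsOpenDenseIn D U ∧
      (∀ k, k + 2 ≤ n → ∀ q ∈ D,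
        Module.finrank ℝ ((controlFlag U g₁ g₂ k).atPoint q) = 2 + k) ∧
      (∀ k, 1 ≤ k → k + 3 ≤ n → ∀ q ∈ D, ∀ θ ∈ (controlFlag U g₁ g₂ k).annihilator,
        lieDerivOneForm f θ q ∈ (controlFlag U g₁ g₂ k).annihilator.retracting q)) :
    ∃ V : Set (State n), IsOpenDenseIn V U ∧ ∀ p ∈ V, TriangularAround U f g₁ g₂ p := by
  obtain ⟨D, ⟨hDo, hDU, hUD⟩, hdim, hLie⟩ := hD
  refine ⟨{p | TriangularAround U f g₁ g₂ p}, ⟨isOpen_setOf_triangularAround, ?_, ?_⟩,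
    fun p hp => hp⟩
  · rintro p ⟨φ, -, -, -, hp, hφU, -⟩
    exact hφU hp
  · intro x hx
    rw [mem_closure_iff]
    intro O hO hxO
    have hWU : O ∩ D ⊆ U := fun y hy => hDU hy.2
    have hne : (O ∩ D).Nonempty := mem_closure_iff.1 (hUD hx) O hO hxO
    obtain ⟨j, rfl⟩ : ∃ j, n = j + 2 := ⟨n - 2, by omega⟩
    obtain ⟨W, w, hW, ⟨p, hp⟩, hWOD, hw⟩ := exists_partialChain hU hg₁ hg₂ (hO.inter hDo) hWU
      (fun k hk q hq => hdim k hk q hq.2) hne (le_refl (j + 2))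
    exact ⟨p, (hWOD hp).1, hw.triangularAround hn hU hf hg₁ hg₂ hW (hWOD.trans hWU)
      (fun k hk q hq => hdim k hk q (hWOD hq).2)
      (fun k hk hk' q hq => hLie k hk hk' q (hWOD hq).2) rfl hp⟩
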